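/- Let $L>0$, $Z\in\mathbb R\setminus\{0\}$ and $\omega>Z^2/4$. For $k\in(0,1)$ let $K(k)$ be the complete elliptic integral of the first kind and $\mathrm{dn}(\cdot;k)$ the Jacobian elliptic function of modulus $k$; let $\mathrm{dn}^{-1}(\cdot;k):[\sqrt{1-k^2},1]\to[0,K(k)]$ be the inverse of its restriction to $[0,K(k)]$. Put $$\theta=-\tfrac{\sqrt2}{4}|Z|+\sqrt{\omega-\tfrac{Z^2}{8}},\qquad \lambda=\tfrac{\sqrt2}{4}|Z|+\sqrt{\omega-\tfrac{Z^2}{8}},$$ and, for $\eta\in(0,\theta)$, $$\eta_1=\sqrt{2\omega-\eta^2},\quad k^2=\frac{2\omega-2\eta^2}{2\omega-\eta^2},\quad \Phi^2=\tfrac12\Big(2\omega-\tfrac{Z^2}{2}+\sqrt{(2\omega-\tfrac{Z^2}{2})^2-4\eta^2(2\omega-\eta^2)}\Big),\quad a=\mathrm{dn}^{-1}\Big(\frac{\Phi}{\eta_1};k\Big),$$ with $k,\Phi>0$, and $T_\mp(\eta)=\frac{2\sqrt2}{\eta_1}\,(K(k)\mp a)$. Put also $$T_1=\frac{2\sqrt2}{\lambda}\,(K(k_0)+a_0),\qquad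 k_0^2=\frac{\sqrt2\,|Z|\sqrt{\omega-Z^2/8}}{\lambda^2},\qquad a_0=\mathrm{dn}^{-1}\Big(\frac{\sqrt{\omega-Z^2/4}}{\lambda};k_0\Big).$$ Let $\eta\in(0,\theta)$ be such that $T_-(\eta)=2L$ if $Z>0$, and such that $T_+(\eta)=2L>T_1$ if $Z<0$. Let $\varphi_{\omega,Z}$ be the dnoidal peak, i.e. the $2L$-periodic function with $$\varphi_{\omega,Z}(\xi)=\eta_1\,\mathrm{dn}\Big(\frac{\eta_1}{\sqrt2}|\xi|+\mathrm{sgn}(Z)\,a;\,k\Big),\qquad \xi\in[-L,L].$$ Then the operator $$\mathcal L_{1,Z}\,\zeta=-\zeta''+\omega\zeta-3\varphi_{\omega,Z}^2\,\zeta$$ on $L^2_{per}([-L,L])$ ($\zeta''$ being taken off the points $2nL$, $n\in\mathbb Z$), with the $\delta$-interaction domain $$\mathcal D=\big\{\zeta\in H^1_{per}([-L,L])\cap H^2((-L,L)\setminus\{0\})\cap H^2((2nL,2(n+1)L))\ (n\in\mathbb Z):\ \zeta'(0+)-\zeta'(0-)=-Z\,\zeta(0)\big\},$$ has trivial kernel: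 if $\zeta\in\mathcal D$ and $\mathcal L_{1,Z}\zeta=0$, then $\zeta=0$. -/

import Mathlib

open MeasureTheory Set Filter Topology

noncomputable section

namespace DeltaNLS

/-! ### Elliptic integrals and Jacobian elliptic functions of modulus `k` -/

/-- Normal elliptic integral of the first kind `F(φ, k) = ∫₀^φ dθ / √(1 - k² sin² θ)`. -/
def ellF (φ k : ℝ) : ℝ :=
  ∫ θ in (0 : ℝ)..φ, 1 / Real.sqrt (1 - k ^ 2 * Real.sin θ ^ 2)

/-- Complete elliptic integral of the first kind `K(k) = F(π/2, k)`. -/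
def ellK (k : ℝ) : ℝ := ellF (Real.pi / 2) k

/-- The amplitude: the inverse function of `φ ↦ F(φ, k)`, which is an increasing bijection
of `ℝ` for `0 < k < 1`. -/
def am (u k : ℝ) : ℝ := Function.invFun (fun φ => ellF φ k) u

/-- `sn(u; k)`. -/
def sn (u k : ℝ) : ℝ := Real.sin (am u k)

/-- `dn(u; k) = √(1 - k² sn²(u; k))`. -/
def dn (u k : ℝ) : ℝ := Real.sqrt (1 - k ^ 2 * sn u k ^ 2)

/-- `dn⁻¹(y; k)`: the inverse of the decreasing bijection
`dn(·; k) : [0, K(k)] → [√(1 - k²), 1]`. -/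
def dnInv (y k : ℝ) : ℝ := Function.invFunOn (fun u => dn u k) (Icc 0 (ellK k)) y

/-! ### The parameters of the dnoidal peaks -/

/-- `θ(ω, Z)`, the upper end of the range of the parameter `η = η₂`. -/
def theta (ω Z : ℝ) : ℝ := -(Real.sqrt 2 / 4) * |Z| + Real.sqrt (ω - Z ^ 2 / 8)

/-- `λ(ω, Z)`. -/
def lam (ω Z : ℝ) : ℝ := Real.sqrt 2 / 4 * |Z| + Real.sqrt (ω - Z ^ 2 / 8)

/-- `η₁ = √(2ω - η²)`. -/
def eta1 (η ω : ℝ) : ℝ := Real.sqrt (2 * ω - η ^ 2)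

/-- The modulus, `k² = (2ω - 2η²) / (2ω - η²)`. -/
def modulus (η ω : ℝ) : ℝ := Real.sqrt ((2 * ω - 2 * η ^ 2) / (2 * ω - η ^ 2))

/-- The peak value `Φ`:
`Φ² = ((2ω - Z²/2) + √((2ω - Z²/2)² - 4η²(2ω - η²))) / 2`. -/
def peakValue (η ω Z : ℝ) : ℝ :=
  Real.sqrt (((2 * ω - Z ^ 2 / 2) +
    Real.sqrt ((2 * ω - Z ^ 2 / 2) ^ 2 - 4 * η ^ 2 * (2 * ω - η ^ 2))) / 2)

/-- The shift `a = dn⁻¹(Φ / η₁; k)`. -/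
def shift (η ω Z : ℝ) : ℝ := dnInv (peakValue η ω Z / eta1 η ω) (modulus η ω)

/-- The period function for `Z > 0`. -/
def Tminus (η ω Z : ℝ) : ℝ :=
  2 * Real.sqrt 2 / eta1 η ω * (ellK (modulus η ω) - shift η ω Z)

/-- The period function for `Z < 0`. -/
def Tplus (η ω Z : ℝ) : ℝ :=
  2 * Real.sqrt 2 / eta1 η ω * (ellK (modulus η ω) + shift η ω Z)

/-- The limiting modulus, `k₀² = √2 |Z| √(ω - Z²/8) / λ²`. -/
def modulus0 (ω Z : ℝ) : ℝ :=
  Real.sqrt (Real.sqrt 2 * |Z| * Real.sqrt (ω - Z ^ 2 / 8) / lam ω Z ^ 2)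

/-- The limiting shift, `dn(a₀; k₀) = √(ω - Z²/4) / λ`. -/
def shift0 (ω Z : ℝ) : ℝ := dnInv (Real.sqrt (ω - Z ^ 2 / 4) / lam ω Z) (modulus0 ω Z)

/-- `T₁(ω, Z) = (2√2 / λ) (K(k₀) + a₀)`, the limit of `Tplus` as `η → θ(ω, Z)`. -/
def T1 (ω Z : ℝ) : ℝ :=
  2 * Real.sqrt 2 / lam ω Z * (ellK (modulus0 ω Z) + shift0 ω Z)

/-- `η` is the parameter of the dnoidal peak of period `2L` with frequency `ω` and
strength `Z`. -/
def IsPeakParameter (L Z ω η : ℝ) : Prop :=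
  η ∈ Ioo 0 (theta ω Z) ∧
    ((0 < Z ∧ Tminus η ω Z = 2 * L) ∨
      (Z < 0 ∧ T1 ω Z < 2 * L ∧ Tplus η ω Z = 2 * L))

/-- The dnoidal peak `φ_{ω,Z}`: the `2L`-periodic function equal on `[-L, L]` to
`η₁ dn(η₁ |ξ| / √2 + a; k)` if `Z > 0` and to `η₁ dn(η₁ |ξ| / √2 - a; k)` if `Z < 0`. The point
`ξ = x - 2L round(x / 2L)` is the translate of `x` by a multiple of `2L` that lies in `[-L, L]`. -/
def peak (L Z ω η x : ℝ) : ℝ :=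
  let ξ := x - 2 * L * (round (x / (2 * L)) : ℝ)
  let a := if 0 < Z then shift η ω Z else -shift η ω Z
  eta1 η ω * dn (eta1 η ω / Real.sqrt 2 * |ξ| + a) (modulus η ω)

/-! ### Sobolev spaces on the line -/

/-- `g` is a weak derivative of `f` on the open set `Ω`. -/
def HasWeakDerivOn (f g : ℝ → ℂ) (Ω : Set ℝ) : Prop :=
  LocallyIntegrableOn f Ω ∧ LocallyIntegrableOn g Ω ∧
    ∀ χ : ℝ → ℝ, ContDiff ℝ ((⊤ : ℕ∞) : WithTop ℕ∞) χ → HasCompactSupport χ → tsupport χ ⊆ Ω →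
      ∫ x in Ω, ((deriv χ x : ℝ) : ℂ) * f x = -∫ x in Ω, ((χ x : ℝ) : ℂ) * g x

open Classical in
/-- The weak derivative of `f` on `Ω` (unique up to null sets; `0` if there is none). -/
def weakDeriv (Ω : Set ℝ) (f : ℝ → ℂ) : ℝ → ℂ :=
  if h : ∃ g, HasWeakDerivOn f g Ω then h.choose else 0

/-- `f ∈ Hⁿ(Ω)`. -/
def MemSobolev : ℕ → (ℝ → ℂ) → Set ℝ → Prop
  | 0, f, Ω => MemLp f 2 (volume.restrict Ω)
  | n + 1, f, Ω => MemLp f 2 (volume.restrict Ω) ∧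
      ∃ g, HasWeakDerivOn f g Ω ∧ MemSobolev n g Ω

/-- `f ∈ H¹_per([-L, L])`, every element being represented by its continuous representative:
`f` is continuous and `2L`-periodic, and its distributional derivative on `ℝ` is square
integrable over a period. -/
def MemH1per (L : ℝ) (f : ℝ → ℂ) : Prop :=
  Continuous f ∧ Function.Periodic f (2 * L) ∧
    ∃ g, HasWeakDerivOn f g univ ∧ MemLp g 2 (volume.restrict (Ioo (-L) L))

/-! ### The operator with `δ`-interaction -/

/-- The domain `𝒟` of `-d²/dx² - Zδ`: the `ζ` in
`H¹_per([-L, L]) ∩ H²((-L, L) ∖ {0}) ∩ H²((2nL, 2(n+1)L))`, `n ∈ ℤ`, for which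
`ζ'(0+) - ζ'(0-) = -Z ζ(0)`, the one-sided limits `ζ'(0±)` being required to exist. -/
def deltaDomain (L Z : ℝ) : Set (ℝ → ℂ) :=
  {ζ | MemH1per L ζ ∧
    MemSobolev 2 ζ (Ioo (-L) L \ {0}) ∧
    (∀ n : ℤ, MemSobolev 2 ζ (Ioo (2 * n * L) (2 * (n + 1) * L))) ∧
    ∃ p m : ℂ, Tendsto (deriv ζ) (𝓝[>] 0) (𝓝 p) ∧ Tendsto (deriv ζ) (𝓝[<] 0) (𝓝 m) ∧
      p - m = -(Z : ℂ) * ζ 0}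

/-- `ℒ₁ ζ = -ζ'' + ω ζ - 3 φ² ζ`, as an element of `L²` of the period `(-L, L)`; `ζ''` is the
second weak derivative of `ζ` on `(-L, L) ∖ {0}`. -/
def L1 (L ω : ℝ) (φ : ℝ → ℝ) (ζ : ℝ → ℂ) : ℝ → ℂ := fun x =>
  -weakDeriv (Ioo (-L) L \ {0}) (weakDeriv (Ioo (-L) L \ {0}) ζ) x
    + (ω : ℂ) * ζ x - 3 * (φ x : ℂ) ^ 2 * ζ x

/-- The kernel of the operator `ℒ₁` with domain `𝒟`. -/
def kerL1 (L Z ω : ℝ) (φ : ℝ → ℝ) : Set (ℝ → ℂ) :=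
  {ζ | ζ ∈ deltaDomain L Z ∧ L1 L ω φ ζ =ᵐ[volume.restrict (Ioo (-L) L)] 0}

end DeltaNLS

end

/-!
Let `θ = am(η₁ x / √2 ± a; k)` be the amplitude along the peak. With `R = ω - η²` and
`p = η² (2ω - η²) = ω² - R²` the peak is `φ = √(ω + R cos 2θ)` on `[0, 2L]`, where `θ' = φ / √2`;
it solves `φ'' = (ω - φ²) φ`, is even about `L`, and `φ'(0) = -(Z / 2) φ(0)`.

An element of the kernel is a classical solution of `ζ'' = (ω - 3φ²) ζ` on `(0, 2L)`: off the
midpoint `L` its second weak derivative is known from the equation, and since it is `H²` across `L`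
this determines the second weak derivative on `(0, 2L)`, which is thus continuous
(`exists_classical_of_mem_kerL1`). Such solutions are spanned by `φ'`, odd about `L`, and the
explicit solution `ψ = φ' M - ω φ³ + (2ω² - p) φ`, `M = ∫_L^x (ω φ² - p)`, even about `L`.
Periodicity excludes `φ'`, because `φ'(0) ≠ 0`, and the jump condition excludes `ψ` provided that
`ψ'(0) + (Z / 2) ψ(0) ≠ 0` (`eq_zero_of_fundamental_system`).

With `s = φ(0)²` and `t = 2s - (2ω - Z² / 2) > 0` this Robin expression is a positive multiple of
`t N + Z (ω s + p)`, `N = ∫_0^L (ω φ² - p)` (`evenSolDeriv_add_mul`). If `Z > 0` it is positive, as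
`N = 3 ∫ φ'² - [φ φ'] ≥ -Z s / 2` (`ampIntegral_le`). If `Z < 0`, fix `ω` and `Z` and let `t` (that
is, `η`) vary: `H = N + Z (ω s + p) / t` is a positive multiple of the derivative of the period in
`t`, and `H` is strictly increasing in `t` (`hasDerivAt_periodSlope`). So if `H` vanished at the
given parameter, the period would be strictly decreasing in `t` up to there, hence smaller than its
value `T₁` at `t = 0`, contrary to the assumption (`halfPeriod_lt_of_periodSlope_eq_zero`).
-/

noncomputable section

namespace DeltaNLS

/-! ### Jacobian elliptic functions -/

lemma one_sub_sq_mul_sin_sq_pos {k : ℝ} (h0 : 0 ≤ k) (h1 : k < 1) (θ : ℝ) :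
    0 < 1 - k ^ 2 * Real.sin θ ^ 2 := by
  have := Real.sin_sq_le_one θ
  have := sq_nonneg (Real.sin θ)
  nlinarith [mul_nonneg h0 h0]

lemma continuous_ellF_integrand {k : ℝ} (h0 : 0 ≤ k) (h1 : k < 1) :
    Continuous fun θ : ℝ => 1 / Real.sqrt (1 - k ^ 2 * Real.sin θ ^ 2) := by
  refine continuous_const.div (by fun_prop) fun θ => ?_
  exact (Real.sqrt_pos.2 (one_sub_sq_mul_sin_sq_pos h0 h1 θ)).ne'

lemma hasDerivAt_ellF {k : ℝ} (h0 : 0 ≤ k) (h1 : k < 1) (φ : ℝ) :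
    HasDerivAt (fun φ => ellF φ k) (1 / Real.sqrt (1 - k ^ 2 * Real.sin φ ^ 2)) φ :=
  intervalIntegral.integral_hasDerivAt_right
    ((continuous_ellF_integrand h0 h1).intervalIntegrable _ _)
    ((continuous_ellF_integrand h0 h1).stronglyMeasurableAtFilter _ _)
    (continuous_ellF_integrand h0 h1).continuousAt

@[simp] lemma ellF_zero (k : ℝ) : ellF 0 k = 0 := by simp [ellF]

lemma ellF_neg (φ k : ℝ) : ellF (-φ) k = -ellF φ k := by
  have h := intervalIntegral.integral_comp_neg (a := 0) (b := φ)
    (fun θ : ℝ => 1 / Real.sqrt (1 - k ^ 2 * Real.sin θ ^ 2))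
  simp only [Real.sin_neg, neg_sq, neg_zero] at h
  rw [ellF, ellF, h, intervalIntegral.integral_symm]

lemma strictMono_ellF {k : ℝ} (h0 : 0 ≤ k) (h1 : k < 1) : StrictMono fun φ => ellF φ k := by
  refine strictMono_of_deriv_pos fun φ => ?_
  rw [(hasDerivAt_ellF h0 h1 φ).deriv]
  exact one_div_pos.2 (Real.sqrt_pos.2 (one_sub_sq_mul_sin_sq_pos h0 h1 φ))

lemma monotone_ellF_sub {k : ℝ} (h0 : 0 ≤ k) (h1 : k < 1) : Monotone fun φ => ellF φ k - φ := by
  have hd φ := (hasDerivAt_ellF h0 h1 φ).sub (hasDerivAt_id φ)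
  refine monotone_of_deriv_nonneg (fun φ => (hd φ).differentiableAt) fun φ => ?_
  rw [show (fun φ => ellF φ k - φ) = (fun φ => ellF φ k) - id from rfl, (hd φ).deriv]
  have hp := one_sub_sq_mul_sin_sq_pos h0 h1 φ
  have : Real.sqrt (1 - k ^ 2 * Real.sin φ ^ 2) ≤ 1 := by
    have : 0 ≤ k ^ 2 * Real.sin φ ^ 2 := by positivity
    exact Real.sqrt_le_iff.2 ⟨zero_le_one, by linarith⟩
  have := (one_le_div (Real.sqrt_pos.2 hp)).2 this
  linarith

lemma surjective_ellF {k : ℝ} (h0 : 0 ≤ k) (h1 : k < 1) :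
    Function.Surjective fun φ => ellF φ k := by
  have hc : Continuous fun φ => ellF φ k :=
    continuous_iff_continuousAt.2 fun φ => (hasDerivAt_ellF h0 h1 φ).continuousAt
  refine hc.surjective ?_ ?_
  · refine tendsto_atTop_mono' _ ?_ tendsto_id
    filter_upwards [eventually_ge_atTop 0] with φ hφ
    have := monotone_ellF_sub h0 h1 hφ
    simp only [ellF_zero] at this
    simp only [id]; linarith
  · refine tendsto_atBot_mono' _ ?_ tendsto_id
    filter_upwards [eventually_le_atBot 0] with φ hφ
    have := monotone_ellF_sub h0 h1 hφ
    simp only [ellF_zero] at this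
    simp only [id]; linarith

lemma am_ellF {k : ℝ} (h0 : 0 ≤ k) (h1 : k < 1) (φ : ℝ) : am (ellF φ k) k = φ :=
  Function.leftInverse_invFun (strictMono_ellF h0 h1).injective φ

lemma ellF_am {k : ℝ} (h0 : 0 ≤ k) (h1 : k < 1) (u : ℝ) : ellF (am u k) k = u :=
  Function.rightInverse_invFun (surjective_ellF h0 h1) u

lemma continuous_am {k : ℝ} (h0 : 0 ≤ k) (h1 : k < 1) : Continuous fun u => am u k := by
  have h : (fun u => am u k)
      = ((strictMono_ellF h0 h1).orderIsoOfSurjective _ (surjective_ellF h0 h1)).symm := by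
    funext u
    rw [OrderIso.eq_symm_apply]
    exact ellF_am h0 h1 u
  rw [h]
  exact OrderIso.continuous _

lemma dn_eq (u k : ℝ) : dn u k = Real.sqrt (1 - k ^ 2 * Real.sin (am u k) ^ 2) := rfl

lemma hasDerivAt_am {k : ℝ} (h0 : 0 ≤ k) (h1 : k < 1) (u : ℝ) :
    HasDerivAt (fun u => am u k) (dn u k) u := by
  have hp := Real.sqrt_pos.2 (one_sub_sq_mul_sin_sq_pos h0 h1 (am u k))
  have h := HasDerivAt.of_local_left_inverse (f := fun φ => ellF φ k) (g := fun u => am u k)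
    (continuous_am h0 h1).continuousAt (hasDerivAt_ellF h0 h1 (am u k))
    (one_div_pos.2 hp).ne' (Eventually.of_forall fun u => ellF_am h0 h1 u)
  rwa [one_div, inv_inv] at h

lemma am_neg {k : ℝ} (h0 : 0 ≤ k) (h1 : k < 1) (u : ℝ) : am (-u) k = -am u k := by
  rw [← am_ellF h0 h1 (-am u k), ellF_neg, ellF_am h0 h1]

lemma ellF_pi_sub {k : ℝ} (h0 : 0 ≤ k) (h1 : k < 1) (φ : ℝ) :
    ellF (Real.pi - φ) k = 2 * ellK k - ellF φ k := by
  have hd (φ : ℝ) : HasDerivAt (fun φ => ellF (Real.pi - φ) k + ellF φ k) 0 φ := by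
    have h2 := ((hasDerivAt_ellF h0 h1 (Real.pi - φ)).comp φ
      ((hasDerivAt_id φ).const_sub Real.pi)).add (hasDerivAt_ellF h0 h1 φ)
    exact h2.congr_deriv (by rw [Real.sin_pi_sub]; ring)
  have h := is_const_of_deriv_eq_zero (fun φ => (hd φ).differentiableAt)
    (fun φ => (hd φ).deriv) φ (Real.pi / 2)
  simp only [show Real.pi - Real.pi / 2 = Real.pi / 2 by ring] at h
  rw [ellK]; linarith

lemma am_two_mul_ellK_sub {k : ℝ} (h0 : 0 ≤ k) (h1 : k < 1) (u : ℝ) :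
    am (2 * ellK k - u) k = Real.pi - am u k := by
  rw [← am_ellF h0 h1 (Real.pi - am u k), ellF_pi_sub h0 h1, ellF_am h0 h1]

/-- `dn⁻¹` in terms of the elliptic integral: if `y = √(1 - k² sin² b)` with `0 ≤ b ≤ π / 2`, then
`dn⁻¹(y; k) = F(b, k)`. -/
lemma dnInv_eq_ellF {k b : ℝ} (h0 : 0 < k) (h1 : k < 1) (hb0 : 0 ≤ b) (hb1 : b ≤ Real.pi / 2) :
    dnInv (Real.sqrt (1 - k ^ 2 * Real.sin b ^ 2)) k = ellF b k := by
  have hmono := strictMono_ellF h0.le h1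
  have hmem : ellF b k ∈ Icc 0 (ellK k) :=
    ⟨by simpa using hmono.monotone hb0, hmono.monotone hb1⟩
  have hex : ∃ u ∈ Icc 0 (ellK k), dn u k = Real.sqrt (1 - k ^ 2 * Real.sin b ^ 2) :=
    ⟨_, hmem, by rw [dn_eq, am_ellF h0.le h1]⟩
  have hm := Function.invFunOn_mem hex
  have he := Function.invFunOn_eq hex
  change dnInv (Real.sqrt (1 - k ^ 2 * Real.sin b ^ 2)) k ∈ _ at hm
  change dn (dnInv (Real.sqrt (1 - k ^ 2 * Real.sin b ^ 2)) k) k = _ at he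
  set u := dnInv (Real.sqrt (1 - k ^ 2 * Real.sin b ^ 2)) k
  have ha0 : 0 ≤ am u k := by
    rw [← hmono.le_iff_le]; simpa [ellF_am h0.le h1] using hm.1
  have ha1 : am u k ≤ Real.pi / 2 := by
    rw [← hmono.le_iff_le]; simpa [ellF_am h0.le h1] using (show u ≤ ellF (Real.pi / 2) k from hm.2)
  rw [dn_eq, Real.sqrt_inj (one_sub_sq_mul_sin_sq_pos h0.le h1 _).le
    (one_sub_sq_mul_sin_sq_pos h0.le h1 _).le] at he
  have hs : Real.sin (am u k) ^ 2 = Real.sin b ^ 2 := by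
    have : k ^ 2 ≠ 0 := by positivity
    exact mul_left_cancel₀ this (by linarith)
  have hpi := Real.pi_pos
  have hs' : Real.sin (am u k) = Real.sin b :=
    (sq_eq_sq₀ (Real.sin_nonneg_of_nonneg_of_le_pi ha0 (by linarith))
      (Real.sin_nonneg_of_nonneg_of_le_pi hb0 (by linarith))).1 hs
  have : am u k = b := Real.injOn_sin ⟨by linarith, ha1⟩ ⟨by linarith, hb1⟩ hs'
  rw [← this, ellF_am h0.le h1]

/-! ### The dnoidal profile and the linearized equation -/

/-- The dnoidal wave as a function of the amplitude `θ`: with `η₁² = ω + R` and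
`k² = 2R / (ω + R)`, the number `η₁ √(1 - k² sin² θ)` equals `√(ω + R cos 2θ)`. -/
def waveAt (ω R θ : ℝ) : ℝ := Real.sqrt (ω + R * Real.cos (2 * θ))

lemma waveAt_radicand_pos {ω R : ℝ} (h : |R| < ω) (θ : ℝ) : 0 < ω + R * Real.cos (2 * θ) := by
  have h1 : |R * Real.cos (2 * θ)| ≤ |R| := by
    rw [abs_mul]
    exact mul_le_of_le_one_right (abs_nonneg _) (Real.abs_cos_le_one _)
  linarith [neg_abs_le (R * Real.cos (2 * θ))]

lemma waveAt_pos {ω R : ℝ} (h : |R| < ω) (θ : ℝ) : 0 < waveAt ω R θ :=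
  Real.sqrt_pos.2 (waveAt_radicand_pos h θ)

lemma waveAt_sq {ω R : ℝ} (h : |R| < ω) (θ : ℝ) :
    waveAt ω R θ ^ 2 = ω + R * Real.cos (2 * θ) :=
  Real.sq_sqrt (waveAt_radicand_pos h θ).le

lemma continuous_waveAt (ω R : ℝ) : Continuous (waveAt ω R) := by
  unfold waveAt; fun_prop

lemma hasDerivAt_waveAt {ω R : ℝ} (h : |R| < ω) (θ : ℝ) :
    HasDerivAt (waveAt ω R) (-(R * Real.sin (2 * θ)) / waveAt ω R θ) θ := by
  have h2 : HasDerivAt (fun θ : ℝ => 2 * θ) 2 θ := by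
    simpa using (hasDerivAt_id θ).const_mul 2
  have h1 : HasDerivAt (fun θ => ω + R * Real.cos (2 * θ)) (R * (-Real.sin (2 * θ) * 2)) θ :=
    (h2.cos.const_mul R).const_add ω
  refine (h1.sqrt (waveAt_radicand_pos h θ).ne').congr_deriv ?_
  have := (waveAt_pos h θ).ne'
  unfold waveAt at *
  field_simp

lemma sq_mul_sin_sq_eq {ω R : ℝ} (h : |R| < ω) (θ : ℝ) :
    (R * Real.sin (2 * θ)) ^ 2
      = 2 * ω * waveAt ω R θ ^ 2 - waveAt ω R θ ^ 4 - (ω ^ 2 - R ^ 2) := by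
  have h1 := waveAt_sq h θ
  have h2 := Real.sin_sq_add_cos_sq (2 * θ)
  rw [show waveAt ω R θ ^ 4 = (waveAt ω R θ ^ 2) ^ 2 by ring, h1]
  linear_combination R ^ 2 * h2

/-- `∫ (ω φ² - p) dx` along the wave, with `p = ω² - R²`, written in terms of the amplitude and
normalized to vanish at the minimum `θ = π / 2` of the wave. -/
def ampIntegral (ω R θ : ℝ) : ℝ :=
  Real.sqrt 2 * ∫ τ in (Real.pi / 2)..θ, (ω * waveAt ω R τ - (ω ^ 2 - R ^ 2) / waveAt ω R τ)

lemma continuous_ampIntegrand {ω R : ℝ} (h : |R| < ω) :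
    Continuous fun τ => ω * waveAt ω R τ - (ω ^ 2 - R ^ 2) / waveAt ω R τ :=
  ((continuous_waveAt ω R).const_mul ω).sub
    (continuous_const.div (continuous_waveAt ω R) fun θ => (waveAt_pos h θ).ne')

lemma hasDerivAt_ampIntegral {ω R : ℝ} (h : |R| < ω) (θ : ℝ) :
    HasDerivAt (ampIntegral ω R)
      (Real.sqrt 2 * (ω * waveAt ω R θ - (ω ^ 2 - R ^ 2) / waveAt ω R θ)) θ :=
  (intervalIntegral.integral_hasDerivAt_right
    ((continuous_ampIntegrand h).intervalIntegrable _ _)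
    ((continuous_ampIntegrand h).stronglyMeasurableAtFilter _ _)
    (continuous_ampIntegrand h).continuousAt).const_mul _

/-- The wave has mirror symmetry about its minimum. -/
lemma waveAt_pi_sub (ω R θ : ℝ) : waveAt ω R (Real.pi - θ) = waveAt ω R θ := by
  unfold waveAt
  rw [show 2 * (Real.pi - θ) = 2 * Real.pi - 2 * θ by ring, Real.cos_two_pi_sub]

lemma ampIntegral_pi_sub {ω R : ℝ} (h : |R| < ω) (θ : ℝ) :
    ampIntegral ω R (Real.pi - θ) = -ampIntegral ω R θ := by
  have hd (θ : ℝ) :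
      HasDerivAt (fun θ => ampIntegral ω R (Real.pi - θ) + ampIntegral ω R θ) 0 θ := by
    have h2 := ((hasDerivAt_ampIntegral h (Real.pi - θ)).comp θ
      ((hasDerivAt_id θ).const_sub Real.pi)).add (hasDerivAt_ampIntegral h θ)
    exact h2.congr_deriv (by rw [waveAt_pi_sub]; ring)
  have h := is_const_of_deriv_eq_zero (fun θ => (hd θ).differentiableAt)
    (fun θ => (hd θ).deriv) θ (Real.pi / 2)
  simp only [show Real.pi - Real.pi / 2 = Real.pi / 2 by ring] at h
  have h0 : ampIntegral ω R (Real.pi / 2) = 0 := by simp [ampIntegral]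
  linarith

/-- The derivative of the wave, as a function of the amplitude. -/
def slopeAt (R θ : ℝ) : ℝ := -(R * Real.sin (2 * θ) / Real.sqrt 2)

lemma slopeAt_pi_sub (R θ : ℝ) : slopeAt R (Real.pi - θ) = -slopeAt R θ := by
  unfold slopeAt
  rw [show 2 * (Real.pi - θ) = 2 * Real.pi - 2 * θ by ring, Real.sin_two_pi_sub]
  ring

lemma slopeAt_sq {ω R : ℝ} (h : |R| < ω) (θ : ℝ) :
    slopeAt R θ ^ 2
      = ω * waveAt ω R θ ^ 2 - waveAt ω R θ ^ 4 / 2 - (ω ^ 2 - R ^ 2) / 2 := by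
  have := sq_mul_sin_sq_eq h θ
  rw [slopeAt, neg_sq, div_pow, Real.sq_sqrt zero_le_two, this]
  ring

/-- The solution `ψ = φ' M - ω φ³ + (2ω² - p) φ` of the linearized equation
`ψ'' = (ω - 3φ²) ψ` that is even about the minimum of `φ`; here `M = ∫ (ω φ² - p) dx`. -/
def evenSol (ω R θ : ℝ) : ℝ :=
  slopeAt R θ * ampIntegral ω R θ - ω * waveAt ω R θ ^ 3
    + (2 * ω ^ 2 - (ω ^ 2 - R ^ 2)) * waveAt ω R θ

/-- The derivative of `evenSol` along the wave. -/
def evenSolDeriv (ω R θ : ℝ) : ℝ :=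
  (ω - waveAt ω R θ ^ 2) * waveAt ω R θ * ampIntegral ω R θ
    + 2 * slopeAt R θ * (ω ^ 2 - (ω ^ 2 - R ^ 2) - ω * waveAt ω R θ ^ 2)

lemma evenSol_pi_sub {ω R : ℝ} (h : |R| < ω) (θ : ℝ) :
    evenSol ω R (Real.pi - θ) = evenSol ω R θ := by
  simp only [evenSol, waveAt_pi_sub, slopeAt_pi_sub, ampIntegral_pi_sub h]; ring

lemma evenSolDeriv_pi_sub {ω R : ℝ} (h : |R| < ω) (θ : ℝ) :
    evenSolDeriv ω R (Real.pi - θ) = -evenSolDeriv ω R θ := by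
  simp only [evenSolDeriv, waveAt_pi_sub, slopeAt_pi_sub, ampIntegral_pi_sub h]; ring

section Profile

variable {ω R : ℝ} {θ : ℝ → ℝ}

lemma hasDerivAt_wave (h : |R| < ω)
    (hθ : ∀ x, HasDerivAt θ (waveAt ω R (θ x) / Real.sqrt 2) x) (x : ℝ) :
    HasDerivAt (fun x => waveAt ω R (θ x)) (slopeAt R (θ x)) x := by
  refine ((hasDerivAt_waveAt h (θ x)).comp x (hθ x)).congr_deriv ?_
  have := (waveAt_pos h (θ x)).ne'
  unfold slopeAt
  field_simp

lemma hasDerivAt_slope (h : |R| < ω)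
    (hθ : ∀ x, HasDerivAt θ (waveAt ω R (θ x) / Real.sqrt 2) x) (x : ℝ) :
    HasDerivAt (fun x => slopeAt R (θ x))
      ((ω - waveAt ω R (θ x) ^ 2) * waveAt ω R (θ x)) x := by
  refine (((((hθ x).const_mul 2).sin).const_mul R).div_const (Real.sqrt 2)).neg.congr_deriv ?_
  rw [waveAt_sq h]
  have : Real.sqrt 2 ≠ 0 := by positivity
  field_simp
  rw [Real.sq_sqrt zero_le_two]
  ring

lemma hasDerivAt_ampIntegral_comp (h : |R| < ω)
    (hθ : ∀ x, HasDerivAt θ (waveAt ω R (θ x) / Real.sqrt 2) x) (x : ℝ) :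
    HasDerivAt (fun x => ampIntegral ω R (θ x))
      (ω * waveAt ω R (θ x) ^ 2 - (ω ^ 2 - R ^ 2)) x := by
  refine ((hasDerivAt_ampIntegral h (θ x)).comp x (hθ x)).congr_deriv ?_
  have := (waveAt_pos h (θ x)).ne'
  field_simp

lemma hasDerivAt_evenSol (h : |R| < ω)
    (hθ : ∀ x, HasDerivAt θ (waveAt ω R (θ x) / Real.sqrt 2) x) (x : ℝ) :
    HasDerivAt (fun x => evenSol ω R (θ x)) (evenSolDeriv ω R (θ x)) x := by
  have h1 := hasDerivAt_wave h hθ x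
  have h2 := hasDerivAt_slope h hθ x
  have h3 := hasDerivAt_ampIntegral_comp h hθ x
  refine (((h2.mul h3).sub ((h1.pow 3).const_mul ω)).add
    (h1.const_mul (2 * ω ^ 2 - (ω ^ 2 - R ^ 2)))).congr_deriv ?_
  unfold evenSolDeriv
  push_cast
  ring

lemma hasDerivAt_evenSolDeriv (h : |R| < ω)
    (hθ : ∀ x, HasDerivAt θ (waveAt ω R (θ x) / Real.sqrt 2) x) (x : ℝ) :
    HasDerivAt (fun x => evenSolDeriv ω R (θ x))
      ((ω - 3 * waveAt ω R (θ x) ^ 2) * evenSol ω R (θ x)) x := by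
  have h1 := hasDerivAt_wave h hθ x
  have h2 := hasDerivAt_slope h hθ x
  have h3 := hasDerivAt_ampIntegral_comp h hθ x
  refine (((((h1.pow 2).const_sub ω).mul h1).mul h3).add ((h2.const_mul 2).mul
    (((h1.pow 2).const_mul ω).const_sub (ω ^ 2 - (ω ^ 2 - R ^ 2))))).congr_deriv ?_
  have hs := slopeAt_sq h (θ x)
  simp only [evenSol, Pi.mul_apply, Pi.pow_apply]
  push_cast
  linear_combination (-4 * ω * waveAt ω R (θ x)) * hs

lemma hasDerivAt_slopeDeriv (h : |R| < ω)
    (hθ : ∀ x, HasDerivAt θ (waveAt ω R (θ x) / Real.sqrt 2) x) (x : ℝ) :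
    HasDerivAt (fun x => (ω - waveAt ω R (θ x) ^ 2) * waveAt ω R (θ x))
      ((ω - 3 * waveAt ω R (θ x) ^ 2) * slopeAt R (θ x)) x := by
  have h1 := hasDerivAt_wave h hθ x
  refine (((h1.pow 2).const_sub ω).mul h1).congr_deriv ?_
  simp only [Pi.pow_apply]
  push_cast
  ring

end Profile

/-! ### Integrals depending on a parameter -/

/-- Differentiation under the integral sign with a moving upper endpoint. -/
lemma hasDerivAt_integral_param_endpoint {f f' : ℝ → ℝ → ℝ} {U : Set ℝ} (hU : IsOpen U)
    (hf : ContinuousOn (Function.uncurry f) (U ×ˢ univ))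
    (hf' : ContinuousOn (Function.uncurry f') (U ×ˢ univ))
    (hd : ∀ r ∈ U, ∀ θ, HasDerivAt (fun r => f r θ) (f' r θ) r)
    {r b : ℝ → ℝ} {r' b' t : ℝ} (hr : HasDerivAt r r' t) (hb : HasDerivAt b b' t)
    (hrt : r t ∈ U) :
    HasDerivAt (fun t => ∫ θ in (0 : ℝ)..b t, f (r t) θ)
      (r' * (∫ θ in (0 : ℝ)..b t, f' (r t) θ) + b' * f (r t) (b t)) t := by
  have hcont : ∀ r ∈ U, Continuous (f r) := fun r hr => by
    have : ContinuousOn (fun θ => Function.uncurry f (r, θ)) univ :=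
      hf.comp (by fun_prop) fun θ _ => ⟨hr, mem_univ _⟩
    exact continuousOn_univ.1 this
  have hcont' : ∀ r ∈ U, Continuous (f' r) := fun r hr => by
    have : ContinuousOn (fun θ => Function.uncurry f' (r, θ)) univ :=
      hf'.comp (by fun_prop) fun θ _ => ⟨hr, mem_univ _⟩
    exact continuousOn_univ.1 this
  -- the derivative in the parameter, the endpoint being frozen
  have h1 : HasDerivAt (fun ρ => ∫ θ in (0 : ℝ)..b t, f ρ θ)
      (∫ θ in (0 : ℝ)..b t, f' (r t) θ) (r t) := by
    obtain ⟨δ, hδ, hball⟩ := Metric.isOpen_iff.1 hU _ hrt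
    have hsub : Metric.closedBall (r t) (δ / 2) ⊆ U :=
      (Metric.closedBall_subset_ball (half_lt_self hδ)).trans hball
    obtain ⟨C, hC⟩ := ((isCompact_closedBall (r t) (δ / 2)).prod
      (isCompact_uIcc (a := 0) (b := b t))).exists_bound_of_continuousOn
      (hf'.mono (prod_mono hsub (subset_univ _)))
    refine (intervalIntegral.hasDerivAt_integral_of_dominated_loc_of_deriv_le
      (s := Metric.closedBall (r t) (δ / 2)) (bound := fun _ => C)
      (Metric.closedBall_mem_nhds _ (half_pos hδ)) ?_ ?_ ?_ ?_ ?_ ?_).2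
    · filter_upwards [hU.mem_nhds hrt] with ρ hρ
      exact (hcont ρ hρ).aestronglyMeasurable
    · exact (hcont _ hrt).intervalIntegrable _ _
    · exact (hcont' _ hrt).aestronglyMeasurable
    · exact Eventually.of_forall fun θ hθ ρ hρ => hC (ρ, θ) ⟨hρ, uIoc_subset_uIcc hθ⟩
    · exact intervalIntegrable_const
    · exact Eventually.of_forall fun θ _ ρ hρ => hd ρ (hsub hρ) θ
  -- the contribution of the moving endpoint
  have h2 : HasDerivAt (fun τ => ∫ θ in b t..b τ, f (r τ) θ) (b' * f (r t) (b t)) t := by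
    have h3 : (fun τ => (∫ θ in b t..b τ, f (r τ) θ) - (b τ - b t) * f (r t) (b t))
        =o[𝓝 t] fun τ => b τ - b t := by
      refine Asymptotics.isLittleO_iff.2 fun ε hε => ?_
      have hca : ContinuousAt (Function.uncurry f) (r t, b t) :=
        hf.continuousAt ((hU.prod isOpen_univ).mem_nhds ⟨hrt, mem_univ _⟩)
      obtain ⟨δ, hδ, hclose⟩ := Metric.continuousAt_iff.1 hca ε hε
      filter_upwards [hr.continuousAt.eventually (Metric.ball_mem_nhds _ hδ),
        hb.continuousAt.eventually (Metric.ball_mem_nhds _ hδ),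
        hr.continuousAt.eventually (hU.mem_nhds hrt)] with τ hτr hτb hτU
      have he : (∫ θ in b t..b τ, f (r τ) θ) - (b τ - b t) * f (r t) (b t)
          = ∫ θ in b t..b τ, (f (r τ) θ - f (r t) (b t)) := by
        rw [intervalIntegral.integral_sub ((hcont _ hτU).intervalIntegrable _ _)
          intervalIntegrable_const, intervalIntegral.integral_const, smul_eq_mul]
      rw [he]
      refine intervalIntegral.norm_integral_le_of_norm_le_const fun θ hθ => ?_
      rw [← dist_eq_norm]
      refine (hclose (x := (r τ, θ)) ?_).le
      rw [Prod.dist_eq]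
      refine max_lt hτr (lt_of_le_of_lt ?_ hτb)
      have hθ' := abs_sub_left_of_mem_uIcc (uIoc_subset_uIcc hθ)
      rwa [Real.dist_eq, Real.dist_eq]
    have h4 : HasDerivAt (fun τ => (∫ θ in b t..b τ, f (r τ) θ) - (b τ - b t) * f (r t) (b t))
        0 t := by
      rw [hasDerivAt_iff_isLittleO]
      simpa using h3.trans_isBigO hb.isBigO_sub
    have h5 := h4.add ((hb.sub_const (b t)).mul_const (f (r t) (b t)))
    refine (h5.congr_deriv (zero_add _)).congr_of_eventuallyEq (Eventually.of_forall fun τ => ?_)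
    simp
  have h6 := (h1.comp t hr).add h2
  refine (h6.congr_deriv (by ring)).congr_of_eventuallyEq ?_
  filter_upwards [hr.continuousAt.eventually (hU.mem_nhds hrt)] with τ hτ
  exact (intervalIntegral.integral_add_adjacent_intervals
    ((hcont _ hτ).intervalIntegrable _ _) ((hcont _ hτ).intervalIntegrable _ _)).symm

/-- `∫₀ᵇ √(ω + R cos 2θ) dθ`. -/
def waveInt (ω R b : ℝ) : ℝ := ∫ θ in (0 : ℝ)..b, waveAt ω R θ

/-- `∫₀ᵇ dθ / √(ω + R cos 2θ)`. -/
def invWaveInt (ω R b : ℝ) : ℝ := ∫ θ in (0 : ℝ)..b, 1 / waveAt ω R θ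

lemma continuousOn_waveAt_uncurry (ω : ℝ) (s : Set (ℝ × ℝ)) :
    ContinuousOn (Function.uncurry (waveAt ω)) s := by
  unfold waveAt
  exact Continuous.continuousOn (by fun_prop)

lemma continuous_inv_waveAt {ω R : ℝ} (h : |R| < ω) : Continuous fun θ => 1 / waveAt ω R θ :=
  continuous_const.div (continuous_waveAt ω R) fun θ => (waveAt_pos h θ).ne'

lemma hasDerivAt_waveAt_param {ω R : ℝ} (h : |R| < ω) (θ : ℝ) :
    HasDerivAt (fun R => waveAt ω R θ) (Real.cos (2 * θ) / (2 * waveAt ω R θ)) R := by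
  have h1 : HasDerivAt (fun R => ω + R * Real.cos (2 * θ)) (Real.cos (2 * θ)) R := by
    simpa using ((hasDerivAt_id R).mul_const (Real.cos (2 * θ))).const_add ω
  exact h1.sqrt (waveAt_radicand_pos h θ).ne'

lemma isOpen_abs_lt (ω : ℝ) : IsOpen {R : ℝ | |R| < ω} := isOpen_lt continuous_abs continuous_const

lemma hasDerivAt_waveInt {ω : ℝ} {r b : ℝ → ℝ} {r' b' t : ℝ} (hr : HasDerivAt r r' t)
    (hb : HasDerivAt b b' t) (h : |r t| < ω) (h0 : r t ≠ 0) :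
    HasDerivAt (fun t => waveInt ω (r t) (b t))
      (r' * ((waveInt ω (r t) (b t) - ω * invWaveInt ω (r t) (b t)) / (2 * r t))
        + b' * waveAt ω (r t) (b t)) t := by
  have hne : ∀ x ∈ {R : ℝ | |R| < ω} ×ˢ (univ : Set ℝ),
      2 * Function.uncurry (waveAt ω) x ≠ 0 := fun x hx =>
    mul_ne_zero two_ne_zero (waveAt_pos hx.1 x.2).ne'
  refine (hasDerivAt_integral_param_endpoint (isOpen_abs_lt ω)
    (f' := fun R θ => Real.cos (2 * θ) / (2 * waveAt ω R θ))
    (continuousOn_waveAt_uncurry ω _) ?_ (fun R hR θ => hasDerivAt_waveAt_param hR θ)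
    hr hb h).congr_deriv ?_
  · exact ContinuousOn.div (by fun_prop)
      (continuousOn_const.mul (continuousOn_waveAt_uncurry ω _)) hne
  · have hc := continuous_inv_waveAt h
    have : (∫ θ in (0 : ℝ)..b t, Real.cos (2 * θ) / (2 * waveAt ω (r t) θ))
        = (waveInt ω (r t) (b t) - ω * invWaveInt ω (r t) (b t)) / (2 * r t) := by
      rw [waveInt, invWaveInt, ← intervalIntegral.integral_const_mul,
        ← intervalIntegral.integral_sub ((continuous_waveAt _ _).intervalIntegrable _ _)
          ((hc.const_mul _).intervalIntegrable _ _), ← intervalIntegral.integral_div]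
      refine intervalIntegral.integral_congr fun θ _ => ?_
      have hp := (waveAt_pos h θ).ne'
      have hs := waveAt_sq h θ
      field_simp
      linear_combination (-1 : ℝ) * hs
    rw [this]

lemma hasDerivAt_sin_div_waveAt {ω R : ℝ} (h : |R| < ω) (θ : ℝ) :
    HasDerivAt (fun θ => R * (R * Real.sin (2 * θ) / waveAt ω R θ))
      (R * (waveAt ω R θ - (ω ^ 2 - R ^ 2) / waveAt ω R θ ^ 3)) θ := by
  have h2 : HasDerivAt (fun θ : ℝ => 2 * θ) 2 θ := by
    simpa using (hasDerivAt_id θ).const_mul 2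
  have hp := (waveAt_pos h θ).ne'
  refine (((h2.sin.const_mul R).div (hasDerivAt_waveAt h θ) hp).const_mul R).congr_deriv ?_
  have hs := waveAt_sq h θ
  have hs2 := sq_mul_sin_sq_eq h θ
  have hc : R * Real.cos (2 * θ) = waveAt ω R θ ^ 2 - ω := by linarith
  congr 1
  field_simp
  linear_combination (2 * waveAt ω R θ ^ 2) * hc + hs2

/-- Reduction of `∫₀ᵇ dθ / w³`, `w = √(ω + R cos 2θ)`, to `∫₀ᵇ w dθ`. -/
lemma integral_inv_waveAt_cube {ω R : ℝ} (h : |R| < ω) (b : ℝ) :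
    (ω ^ 2 - R ^ 2) * (∫ θ in (0 : ℝ)..b, 1 / waveAt ω R θ ^ 3)
      = waveInt ω R b - R * Real.sin (2 * b) / waveAt ω R b := by
  rcases eq_or_ne R 0 with rfl | hR
  · have hω : 0 < ω := by simpa using h
    have : ∀ θ, waveAt ω 0 θ = Real.sqrt ω := fun θ => by simp [waveAt]
    have := (Real.sqrt_pos.2 hω).ne'
    simp only [waveInt, *, intervalIntegral.integral_const, smul_eq_mul]
    field_simp
    rw [Real.sq_sqrt hω.le]; ring
  have hne : ∀ θ, waveAt ω R θ ^ 3 ≠ 0 := fun θ => pow_ne_zero _ (waveAt_pos h θ).ne'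
  have hc3 : Continuous fun θ => 1 / waveAt ω R θ ^ 3 :=
    continuous_const.div ((continuous_waveAt ω R).pow 3) hne
  have hc : Continuous fun θ =>
      R * (waveAt ω R θ - (ω ^ 2 - R ^ 2) / waveAt ω R θ ^ 3) :=
    continuous_const.mul ((continuous_waveAt ω R).sub
      (continuous_const.div ((continuous_waveAt ω R).pow 3) hne))
  have hF := intervalIntegral.integral_eq_sub_of_hasDerivAt (a := 0) (b := b)
    (fun θ _ => hasDerivAt_sin_div_waveAt h θ) (hc.intervalIntegrable _ _)
  rw [intervalIntegral.integral_const_mul] at hF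
  have hI : (∫ θ in (0 : ℝ)..b, (waveAt ω R θ - (ω ^ 2 - R ^ 2) / waveAt ω R θ ^ 3))
      = waveInt ω R b - (ω ^ 2 - R ^ 2) * ∫ θ in (0 : ℝ)..b, 1 / waveAt ω R θ ^ 3 := by
    rw [waveInt, ← intervalIntegral.integral_const_mul,
      ← intervalIntegral.integral_sub ((continuous_waveAt _ _).intervalIntegrable _ _)
        ((hc3.const_mul _).intervalIntegrable _ _)]
    refine intervalIntegral.integral_congr fun θ _ => ?_
    simp only [mul_one_div]
  rw [hI] at hF
  simp only [mul_zero, Real.sin_zero, zero_div, sub_zero] at hF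
  have := mul_left_cancel₀ hR hF
  linarith

lemma hasDerivAt_invWaveInt {ω : ℝ} {r b : ℝ → ℝ} {r' b' t : ℝ} (hr : HasDerivAt r r' t)
    (hb : HasDerivAt b b' t) (h : |r t| < ω) (h0 : r t ≠ 0) :
    HasDerivAt (fun t => invWaveInt ω (r t) (b t))
      (r' * ((-invWaveInt ω (r t) (b t) + ω / (ω ^ 2 - r t ^ 2) *
          (waveInt ω (r t) (b t) - r t * Real.sin (2 * b t) / waveAt ω (r t) (b t)))
            / (2 * r t))
        + b' * (1 / waveAt ω (r t) (b t))) t := by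
  have hne : ∀ x ∈ {R : ℝ | |R| < ω} ×ˢ (univ : Set ℝ),
      Function.uncurry (waveAt ω) x ≠ 0 := fun x hx => (waveAt_pos hx.1 x.2).ne'
  have hD : ∀ R ∈ {R : ℝ | |R| < ω}, ∀ θ, HasDerivAt (fun R => 1 / waveAt ω R θ)
      (-(Real.cos (2 * θ) / (2 * waveAt ω R θ ^ 3))) R := fun R hR θ => by
    have hp := (waveAt_pos hR θ).ne'
    have := (hasDerivAt_waveAt_param hR θ).inv hp
    simp only [one_div]
    refine this.congr_deriv ?_
    field_simp
  refine (hasDerivAt_integral_param_endpoint (isOpen_abs_lt ω)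
    (f := fun R θ => 1 / waveAt ω R θ)
    (f' := fun R θ => -(Real.cos (2 * θ) / (2 * waveAt ω R θ ^ 3)))
    ?_ ?_ hD hr hb h).congr_deriv ?_
  · exact continuousOn_const.div (continuousOn_waveAt_uncurry ω _) hne
  · refine (ContinuousOn.div (by fun_prop)
      (continuousOn_const.mul ((continuousOn_waveAt_uncurry ω _).pow 3)) fun x hx => ?_).neg
    exact mul_ne_zero two_ne_zero (pow_ne_zero _ (hne x hx))
  · have hc := continuous_inv_waveAt h
    have hcn : Continuous fun θ => -(1 / waveAt ω (r t) θ) := hc.neg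
    have hc3 : Continuous fun θ => 1 / waveAt ω (r t) θ ^ 3 :=
      continuous_const.div ((continuous_waveAt _ _).pow 3)
        fun θ => pow_ne_zero _ (waveAt_pos h θ).ne'
    have hpos : ω ^ 2 - r t ^ 2 ≠ 0 := by
      have := sq_lt_sq' (by linarith [neg_abs_le (r t)]) (lt_of_le_of_lt (le_abs_self _) h)
      linarith
    have : (∫ θ in (0 : ℝ)..b t, -(Real.cos (2 * θ) / (2 * waveAt ω (r t) θ ^ 3)))
        = (-invWaveInt ω (r t) (b t) + ω / (ω ^ 2 - r t ^ 2) *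
          (waveInt ω (r t) (b t) - r t * Real.sin (2 * b t) / waveAt ω (r t) (b t)))
            / (2 * r t) := by
      rw [← integral_inv_waveAt_cube h, ← mul_assoc, div_mul_cancel₀ _ hpos, invWaveInt,
        ← intervalIntegral.integral_const_mul, ← intervalIntegral.integral_neg,
        ← intervalIntegral.integral_add (hcn.intervalIntegrable _ _)
          ((hc3.const_mul _).intervalIntegrable _ _), ← intervalIntegral.integral_div]
      refine intervalIntegral.integral_congr fun θ _ => ?_
      have hp := (waveAt_pos h θ).ne'
      have hs := waveAt_sq h θ
      field_simp
      linear_combination hs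
    rw [this]

/-! ### Waves with a given strength of the interaction -/

/-- The squared peak value `s = Φ²` in terms of `t = √((2ω - z²/2)² - 4p)`, `z = |Z|`. -/
def peakSq (ω z t : ℝ) : ℝ := (2 * ω - z ^ 2 / 2 + t) / 2

/-- `p = η² (2ω - η²)` in terms of `t = √((2ω - z²/2)² - 4p)`. -/
def prodSq (ω z t : ℝ) : ℝ := ((2 * ω - z ^ 2 / 2) ^ 2 - t ^ 2) / 4

/-- The half-range `R = √(ω² - p)` of the squared wave `φ² = ω + R cos 2θ`. -/
def halfRange (ω z t : ℝ) : ℝ := Real.sqrt (ω ^ 2 - prodSq ω z t)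

/-- The amplitude `b ∈ (0, π / 2)` at which `φ² = s`. -/
def peakAngle (ω z t : ℝ) : ℝ := Real.arccos ((peakSq ω z t - ω) / halfRange ω z t) / 2

/-- Up to the factor `√2`, the half-period of the wave of strength `-z`. -/
def halfPeriod (ω z t : ℝ) : ℝ :=
  invWaveInt ω (halfRange ω z t) (Real.pi / 2)
    + invWaveInt ω (halfRange ω z t) (peakAngle ω z t)

/-- Up to the factor `√2`, the integral of `φ²` over half a period of the wave of
strength `-z`. -/
def halfMass (ω z t : ℝ) : ℝ :=
  waveInt ω (halfRange ω z t) (Real.pi / 2)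
    + waveInt ω (halfRange ω z t) (peakAngle ω z t)

section Path

variable {ω z t : ℝ}

lemma peakSq_pos (ht0 : 0 ≤ t) (htc : t < 2 * ω - z ^ 2 / 2) : 0 < peakSq ω z t := by
  unfold peakSq; linarith

lemma prodSq_pos (ht0 : 0 ≤ t) (htc : t < 2 * ω - z ^ 2 / 2) : 0 < prodSq ω z t := by
  unfold prodSq; nlinarith

lemma sq_sub_prodSq_pos (hz : 0 < z) (ht0 : 0 ≤ t) (htc : t < 2 * ω - z ^ 2 / 2) :
    0 < ω ^ 2 - prodSq ω z t := by
  unfold prodSq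
  have : 0 < z ^ 2 := by positivity
  nlinarith

lemma halfRange_sq (hz : 0 < z) (ht0 : 0 ≤ t) (htc : t < 2 * ω - z ^ 2 / 2) :
    halfRange ω z t ^ 2 = ω ^ 2 - prodSq ω z t :=
  Real.sq_sqrt (sq_sub_prodSq_pos hz ht0 htc).le

lemma halfRange_pos (hz : 0 < z) (ht0 : 0 ≤ t) (htc : t < 2 * ω - z ^ 2 / 2) :
    0 < halfRange ω z t :=
  Real.sqrt_pos.2 (sq_sub_prodSq_pos hz ht0 htc)

lemma abs_halfRange_lt (hz : 0 < z) (ht0 : 0 ≤ t) (htc : t < 2 * ω - z ^ 2 / 2) :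
    |halfRange ω z t| < ω := by
  have hω : 0 ≤ ω := by nlinarith [sq_nonneg z]
  rw [abs_of_pos (halfRange_pos hz ht0 htc)]
  refine lt_of_pow_lt_pow_left₀ 2 hω ?_
  rw [halfRange_sq hz ht0 htc]
  linarith [prodSq_pos ht0 htc]

/-- The jump condition: at the peak `R² sin² 2b = 2 φ'² = z² s / 2`. -/
lemma halfRange_sq_sub_sq (hz : 0 < z) (ht0 : 0 ≤ t) (htc : t < 2 * ω - z ^ 2 / 2) :
    halfRange ω z t ^ 2 - (peakSq ω z t - ω) ^ 2 = z ^ 2 * peakSq ω z t / 2 := by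
  rw [halfRange_sq hz ht0 htc, prodSq, peakSq]; ring

lemma abs_cos_peak_lt_one (hz : 0 < z) (ht0 : 0 ≤ t) (htc : t < 2 * ω - z ^ 2 / 2) :
    |(peakSq ω z t - ω) / halfRange ω z t| < 1 := by
  have hR := halfRange_pos hz ht0 htc
  rw [abs_div, abs_of_pos hR, div_lt_one hR]
  refine abs_lt_of_sq_lt_sq ?_ hR.le
  have := halfRange_sq_sub_sq hz ht0 htc
  have := peakSq_pos ht0 htc
  have : 0 < z ^ 2 * peakSq ω z t / 2 := by positivity
  linarith

lemma cos_two_mul_peakAngle (hz : 0 < z) (ht0 : 0 ≤ t) (htc : t < 2 * ω - z ^ 2 / 2) :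
    halfRange ω z t * Real.cos (2 * peakAngle ω z t) = peakSq ω z t - ω := by
  have h := abs_lt.1 (abs_cos_peak_lt_one hz ht0 htc)
  rw [peakAngle, mul_div_cancel₀ _ two_ne_zero, Real.cos_arccos h.1.le h.2.le,
    mul_div_cancel₀ _ (halfRange_pos hz ht0 htc).ne']

lemma halfRange_mul_sqrt_one_sub (hz : 0 < z) (ht0 : 0 ≤ t) (htc : t < 2 * ω - z ^ 2 / 2) :
    halfRange ω z t * Real.sqrt (1 - ((peakSq ω z t - ω) / halfRange ω z t) ^ 2)
      = z * Real.sqrt (peakSq ω z t) / Real.sqrt 2 := by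
  have hR := halfRange_pos hz ht0 htc
  have hs := peakSq_pos ht0 htc
  have h := halfRange_sq_sub_sq hz ht0 htc
  have hlt := abs_cos_peak_lt_one hz ht0 htc
  have hlt' := (sq_lt_one_iff_abs_lt_one _).2 hlt
  refine (sq_eq_sq₀ (by positivity) (by positivity)).1 ?_
  rw [mul_pow, Real.sq_sqrt (by linarith), div_pow (z * _), mul_pow, Real.sq_sqrt hs.le,
    Real.sq_sqrt zero_le_two, ← h]
  field_simp

lemma sin_two_mul_peakAngle (hz : 0 < z) (ht0 : 0 ≤ t) (htc : t < 2 * ω - z ^ 2 / 2) :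
    halfRange ω z t * Real.sin (2 * peakAngle ω z t)
      = z * Real.sqrt (peakSq ω z t) / Real.sqrt 2 := by
  rw [peakAngle, mul_div_cancel₀ _ two_ne_zero, Real.sin_arccos,
    halfRange_mul_sqrt_one_sub hz ht0 htc]

lemma waveAt_peakAngle (hz : 0 < z) (ht0 : 0 ≤ t) (htc : t < 2 * ω - z ^ 2 / 2) :
    waveAt ω (halfRange ω z t) (peakAngle ω z t) = Real.sqrt (peakSq ω z t) := by
  rw [waveAt, cos_two_mul_peakAngle hz ht0 htc]; congr 1; ring

lemma peakAngle_nonneg : 0 ≤ peakAngle ω z t := div_nonneg (Real.arccos_nonneg _) zero_le_two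

lemma peakAngle_le : peakAngle ω z t ≤ Real.pi / 2 := by
  unfold peakAngle; linarith [Real.arccos_le_pi ((peakSq ω z t - ω) / halfRange ω z t)]

lemma hasDerivAt_prodSq : HasDerivAt (prodSq ω z) (-t / 2) t := by
  unfold prodSq
  refine ((((hasDerivAt_id t).pow 2).const_sub _).div_const 4).congr_deriv ?_
  simp; ring

lemma hasDerivAt_peakSq : HasDerivAt (peakSq ω z) (1 / 2) t :=
  ((hasDerivAt_id t).const_add _).div_const 2

lemma hasDerivAt_halfRange (hz : 0 < z) (ht0 : 0 ≤ t) (htc : t < 2 * ω - z ^ 2 / 2) :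
    HasDerivAt (halfRange ω z) (t / (4 * halfRange ω z t)) t := by
  refine ((hasDerivAt_prodSq.const_sub (ω ^ 2)).sqrt
    (sq_sub_prodSq_pos hz ht0 htc).ne').congr_deriv ?_
  have := (halfRange_pos hz ht0 htc).ne'
  unfold halfRange at *
  field_simp
  ring

lemma hasDerivAt_peakAngle (hz : 0 < z) (ht0 : 0 ≤ t) (htc : t < 2 * ω - z ^ 2 / 2) :
    HasDerivAt (peakAngle ω z)
      (-(Real.sqrt 2 * z * (peakSq ω z t + ω))
        / (16 * halfRange ω z t ^ 2 * Real.sqrt (peakSq ω z t))) t := by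
  have hR := halfRange_pos hz ht0 htc
  have hs := peakSq_pos ht0 htc
  have h := abs_lt.1 (abs_cos_peak_lt_one hz ht0 htc)
  have hq := halfRange_mul_sqrt_one_sub hz ht0 htc
  have hsq := Real.sq_sqrt hs.le
  have hx := ((hasDerivAt_peakSq (ω := ω) (z := z) (t := t)).sub_const ω).div
    (hasDerivAt_halfRange hz ht0 htc) hR.ne'
  have hc := (Real.hasDerivAt_arccos h.1.ne' h.2.ne).comp t hx
  refine (hc.div_const 2).congr_deriv ?_
  have h2 : Real.sqrt 2 ^ 2 = 2 := Real.sq_sqrt zero_le_two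
  have h2' : Real.sqrt 2 ≠ 0 := by positivity
  set S := Real.sqrt (peakSq ω z t) with hS
  have hSp : 0 < S := Real.sqrt_pos.2 hs
  have hqe : Real.sqrt (1 - ((peakSq ω z t - ω) / halfRange ω z t) ^ 2)
      = z * S / Real.sqrt 2 / halfRange ω z t := by
    rw [← hq]; field_simp
  have hR2 := halfRange_sq_sub_sq hz ht0 htc
  have ht : t = 2 * (peakSq ω z t - ω) + z ^ 2 / 2 := by unfold peakSq; ring
  rw [hqe]
  generalize halfRange ω z t = R at *
  generalize peakSq ω z t = s at *
  field_simp
  have h3 : 2 * R ^ 2 - t * (s - ω) = z ^ 2 * (s + ω) / 2 := by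
    rw [ht]; linear_combination 2 * hR2
  linear_combination (-32 : ℝ) * h3

lemma hasDerivAt_halfPeriod (hz : 0 < z) (ht0 : 0 ≤ t) (htc : t < 2 * ω - z ^ 2 / 2) :
    HasDerivAt (halfPeriod ω z)
      ((Real.sqrt 2 * t * (ω * halfMass ω z t - prodSq ω z t * halfPeriod ω z t)
          - z * (ω * peakSq ω z t + prodSq ω z t))
        / (8 * Real.sqrt 2 * prodSq ω z t * halfRange ω z t ^ 2)) t := by
  have hR := halfRange_pos hz ht0 htc
  have hs := peakSq_pos ht0 htc
  have hp := prodSq_pos ht0 htc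
  have hlt := abs_halfRange_lt hz ht0 htc
  have hRd := hasDerivAt_halfRange hz ht0 htc
  have hd := (hasDerivAt_invWaveInt hRd (hasDerivAt_const t (Real.pi / 2)) hlt hR.ne').add
    (hasDerivAt_invWaveInt hRd (hasDerivAt_peakAngle hz ht0 htc) hlt hR.ne')
  refine hd.congr_deriv ?_
  have hpR : ω ^ 2 - halfRange ω z t ^ 2 = prodSq ω z t := by
    rw [halfRange_sq hz ht0 htc]; ring
  have hpi : Real.sin (2 * (Real.pi / 2)) = 0 := by
    rw [mul_div_cancel₀ _ two_ne_zero, Real.sin_pi]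
  rw [hpR, hpi, sin_two_mul_peakAngle hz ht0 htc, waveAt_peakAngle hz ht0 htc]
  have hR2 := halfRange_sq_sub_sq hz ht0 htc
  have ht : t = 2 * (peakSq ω z t - ω) + z ^ 2 / 2 := by unfold peakSq; ring
  have hps : prodSq ω z t = peakSq ω z t * (peakSq ω z t - t) := by
    unfold prodSq peakSq; ring
  have hSp := Real.sqrt_pos.2 hs
  have hsq := Real.sq_sqrt hs.le
  have h2 : Real.sqrt 2 ^ 2 = 2 := Real.sq_sqrt zero_le_two
  have h2' : 0 < Real.sqrt 2 := by positivity
  rw [halfPeriod, halfMass]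
  generalize Real.sqrt (peakSq ω z t) = S at *
  generalize Real.sqrt 2 = q at *
  generalize invWaveInt ω (halfRange ω z t) (Real.pi / 2) = l1
  generalize invWaveInt ω (halfRange ω z t) (peakAngle ω z t) = l2
  generalize waveInt ω (halfRange ω z t) (Real.pi / 2) = e1
  generalize waveInt ω (halfRange ω z t) (peakAngle ω z t) = e2
  generalize waveAt ω (halfRange ω z t) (Real.pi / 2) = w
  generalize halfRange ω z t = R at *
  generalize prodSq ω z t = p at *
  generalize peakSq ω z t = s at *
  have hbd : t / (4 * R) * (ω / p * (z * S / q / S) / (2 * R))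
      + q * z * (s + ω) / (16 * R ^ 2 * S) * (1 / S) = z * (ω * s + p) / (8 * q * p * R ^ 2) := by
    rw [← hsq] at hps ⊢
    field_simp
    rw [h2, hps]
    ring
  have hmain : t / (4 * R) * ((-l1 + ω / p * (e1 - R * 0 / w)) / (2 * R))
      + t / (4 * R) * ((-l2 + ω / p * e2) / (2 * R))
      = q * t * (ω * (e1 + e2) - p * (l1 + l2)) / (8 * q * p * R ^ 2) := by
    field_simp
    ring
  rw [sub_div, ← hbd, ← hmain]
  ring

/-- By the identity `√2 (ω halfMass - p halfPeriod) = 3 ∫ φ'² + z s / 2` this is a formula for the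
derivative of the action `∫ φ'²`, in which the boundary terms are constant. -/
lemma hasDerivAt_massSubPeriod (hz : 0 < z) (ht0 : 0 ≤ t) (htc : t < 2 * ω - z ^ 2 / 2) :
    HasDerivAt (fun t => ω * halfMass ω z t - prodSq ω z t * halfPeriod ω z t)
      (3 / 8 * t * halfPeriod ω z t - z / (8 * Real.sqrt 2)) t := by
  have hR := halfRange_pos hz ht0 htc
  have hs := peakSq_pos ht0 htc
  have hp := prodSq_pos ht0 htc
  have hlt := abs_halfRange_lt hz ht0 htc
  have hRd := hasDerivAt_halfRange hz ht0 htc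
  have hd := (hasDerivAt_waveInt hRd (hasDerivAt_const t (Real.pi / 2)) hlt hR.ne').add
    (hasDerivAt_waveInt hRd (hasDerivAt_peakAngle hz ht0 htc) hlt hR.ne')
  refine ((hd.const_mul ω).sub
    (hasDerivAt_prodSq.mul (hasDerivAt_halfPeriod hz ht0 htc))).congr_deriv ?_
  have hpR : halfRange ω z t ^ 2 = ω ^ 2 - prodSq ω z t := halfRange_sq hz ht0 htc
  rw [waveAt_peakAngle hz ht0 htc, halfMass, halfPeriod]
  have hSp := Real.sqrt_pos.2 hs
  have h2 : Real.sqrt 2 ^ 2 = 2 := Real.sq_sqrt zero_le_two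
  have h2' : 0 < Real.sqrt 2 := by positivity
  generalize Real.sqrt (peakSq ω z t) = S at *
  generalize Real.sqrt 2 = q at *
  generalize invWaveInt ω (halfRange ω z t) (Real.pi / 2) = l1
  generalize invWaveInt ω (halfRange ω z t) (peakAngle ω z t) = l2
  generalize waveInt ω (halfRange ω z t) (Real.pi / 2) = e1
  generalize waveInt ω (halfRange ω z t) (peakAngle ω z t) = e2
  generalize halfRange ω z t = R at *
  generalize prodSq ω z t = p at *
  generalize peakSq ω z t = s at *
  have hbd : ω * (-(q * z * (s + ω)) / (16 * R ^ 2 * S) * S)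
      + p * (z * (ω * s + p) / (8 * q * p * R ^ 2)) = -z / (8 * q) := by
    field_simp
    rw [h2, hpR]
    ring
  have hmain : ω * (t / (4 * R) * ((e1 - ω * l1) / (2 * R)) + t / (4 * R) * ((e2 - ω * l2) / (2 * R)))
      - (-t / 2 * (l1 + l2)
        + p * (q * t * (ω * (e1 + e2) - p * (l1 + l2)) / (8 * q * p * R ^ 2)))
      = 3 / 8 * t * (l1 + l2) := by
    field_simp
    rw [hpR]
    ring
  rw [sub_eq_add_neg (3 / 8 * t * (l1 + l2)), ← neg_div, ← hbd, ← hmain, sub_div]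
  ring

/-- A positive multiple of the derivative in `t` of the period of the wave of strength `-z`. -/
def periodSlope (ω z t : ℝ) : ℝ :=
  Real.sqrt 2 * (ω * halfMass ω z t - prodSq ω z t * halfPeriod ω z t)
    - z * (ω * peakSq ω z t + prodSq ω z t) / t

/-- All terms of this derivative are positive: `periodSlope` is strictly increasing. -/
lemma hasDerivAt_periodSlope (hz : 0 < z) (ht0 : 0 < t) (htc : t < 2 * ω - z ^ 2 / 2) :
    HasDerivAt (periodSlope ω z)
      (Real.sqrt 2 * (3 / 8 * t * halfPeriod ω z t) + z / 8
        + z * ((2 * ω - z ^ 2 / 2) * (ω / 2) + (2 * ω - z ^ 2 / 2) ^ 2 / 4) / t ^ 2) t := by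
  have h1 := (hasDerivAt_massSubPeriod hz ht0.le htc).const_mul (Real.sqrt 2)
  have h2 := ((((hasDerivAt_peakSq (ω := ω) (z := z) (t := t)).const_mul ω).add
    (hasDerivAt_prodSq (ω := ω) (z := z))).const_mul z).div (hasDerivAt_id t) ht0.ne'
  refine (h1.sub h2).congr_deriv ?_
  have : Real.sqrt 2 ≠ 0 := by positivity
  simp only [Pi.add_apply, id]
  rw [peakSq, prodSq]
  field_simp
  ring

lemma halfPeriod_pos (hz : 0 < z) (ht0 : 0 ≤ t) (htc : t < 2 * ω - z ^ 2 / 2) :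
    0 < halfPeriod ω z t := by
  have hlt := abs_halfRange_lt hz ht0 htc
  have hc := continuous_inv_waveAt hlt
  have hp θ : 0 < 1 / waveAt ω (halfRange ω z t) θ := one_div_pos.2 (waveAt_pos hlt θ)
  refine add_pos_of_pos_of_nonneg ?_ ?_
  · exact intervalIntegral.intervalIntegral_pos_of_pos (hc.intervalIntegrable _ _) hp
      Real.pi_div_two_pos
  · exact intervalIntegral.integral_nonneg peakAngle_nonneg fun θ _ => (hp θ).le

/-- As `periodSlope` is strictly increasing, the period is strictly decreasing in `t` up to a
critical point, where it is therefore smaller than at `t = 0`. -/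
lemma halfPeriod_lt_of_periodSlope_eq_zero (hz : 0 < z) (ht0 : 0 < t)
    (htc : t < 2 * ω - z ^ 2 / 2) (h : periodSlope ω z t = 0) :
    halfPeriod ω z t < halfPeriod ω z 0 := by
  have hneg : ∀ τ ∈ Ioo 0 t, periodSlope ω z τ < 0 := by
    have hmono : StrictMonoOn (periodSlope ω z) (Ioc 0 t) := by
      refine strictMonoOn_of_deriv_pos (convex_Ioc 0 t) ?_ ?_
      · exact fun τ hτ => (hasDerivAt_periodSlope hz hτ.1
          (hτ.2.trans_lt htc)).continuousAt.continuousWithinAt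
      · intro τ hτ
        rw [interior_Ioc] at hτ
        have hτc := hτ.2.trans htc
        rw [(hasDerivAt_periodSlope hz hτ.1 hτc).deriv]
        have := halfPeriod_pos hz hτ.1.le hτc
        have := hτ.1
        have hc : 0 < 2 * ω - z ^ 2 / 2 := ht0.trans htc
        have : 0 < ω := by nlinarith [sq_nonneg z]
        generalize 2 * ω - z ^ 2 / 2 = c at *
        positivity
    intro τ hτ
    rw [← h]
    exact hmono ⟨hτ.1, hτ.2.le⟩ ⟨ht0, le_rfl⟩ hτ.2
  have hanti : StrictAntiOn (halfPeriod ω z) (Icc 0 t) := by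
    refine strictAntiOn_of_deriv_neg (convex_Icc 0 t) ?_ ?_
    · exact fun τ hτ => (hasDerivAt_halfPeriod hz hτ.1
          (hτ.2.trans_lt htc)).continuousAt.continuousWithinAt
    · intro τ hτ
      rw [interior_Icc] at hτ
      have hτc := hτ.2.trans htc
      rw [(hasDerivAt_halfPeriod hz hτ.1.le hτc).deriv]
      have hp := prodSq_pos hτ.1.le hτc
      have hR := halfRange_pos hz hτ.1.le hτc
      refine div_neg_of_neg_of_pos ?_ (by positivity)
      have := mul_neg_of_pos_of_neg hτ.1 (hneg τ hτ)
      rw [periodSlope, mul_sub, mul_div_cancel₀ _ hτ.1.ne'] at this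
      linarith
  exact hanti ⟨le_rfl, ht0.le⟩ ⟨ht0.le, le_rfl⟩ ht0

end Path

/-! ### The dnoidal wave in terms of the amplitude -/

lemma waveMod_lt_one {ω R : ℝ} (hR : 0 < R) (hω : R < ω) :
    Real.sqrt (2 * R / (ω + R)) < 1 := by
  rw [Real.sqrt_lt' one_pos, div_lt_iff₀ (by linarith)]
  linarith

lemma waveMod_pos {ω R : ℝ} (hR : 0 < R) (hω : R < ω) : 0 < Real.sqrt (2 * R / (ω + R)) :=
  Real.sqrt_pos.2 (div_pos (by linarith) (by linarith))

lemma sqrt_mul_dn_radicand {ω R : ℝ} (hR : 0 < R) (hω : R < ω) (θ : ℝ) :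
    Real.sqrt (ω + R) * Real.sqrt (1 - Real.sqrt (2 * R / (ω + R)) ^ 2 * Real.sin θ ^ 2)
      = waveAt ω R θ := by
  have h : 0 < ω + R := by linarith
  have h2 : 0 ≤ 2 * R / (ω + R) := (div_pos (by linarith) h).le
  rw [← Real.sqrt_mul h.le, waveAt, Real.sq_sqrt h2, Real.cos_two_mul, Real.cos_sq']
  congr 1
  field_simp
  ring

lemma sqrt_mul_dn {ω R : ℝ} (hR : 0 < R) (hω : R < ω) (u : ℝ) :
    Real.sqrt (ω + R) * dn u (Real.sqrt (2 * R / (ω + R)))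
      = waveAt ω R (am u (Real.sqrt (2 * R / (ω + R)))) :=
  sqrt_mul_dn_radicand hR hω _

lemma ellF_eq_invWaveInt {ω R : ℝ} (hR : 0 < R) (hω : R < ω) (b : ℝ) :
    ellF b (Real.sqrt (2 * R / (ω + R))) = Real.sqrt (ω + R) * invWaveInt ω R b := by
  rw [ellF, invWaveInt, ← intervalIntegral.integral_const_mul]
  refine intervalIntegral.integral_congr fun θ _ => ?_
  simp only [← sqrt_mul_dn_radicand hR hω θ]
  have h1 := Real.sqrt_pos.2 (show 0 < ω + R by linarith)
  have h2 := Real.sqrt_pos.2 (one_sub_sq_mul_sin_sq_pos (waveMod_pos hR hω).le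
    (waveMod_lt_one hR hω) θ)
  field_simp

lemma dnInv_eq_invWaveInt {ω R b : ℝ} (hR : 0 < R) (hω : R < ω) (hb0 : 0 ≤ b)
    (hb1 : b ≤ Real.pi / 2) :
    dnInv (waveAt ω R b / Real.sqrt (ω + R)) (Real.sqrt (2 * R / (ω + R)))
      = Real.sqrt (ω + R) * invWaveInt ω R b := by
  have h1 := Real.sqrt_pos.2 (show 0 < ω + R by linarith)
  rw [← ellF_eq_invWaveInt hR hω, ← dnInv_eq_ellF (waveMod_pos hR hω) (waveMod_lt_one hR hω) hb0
    hb1, ← sqrt_mul_dn_radicand hR hω b, mul_div_cancel_left₀ _ h1.ne']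

/-- The parameter `t = 2Φ² - (2ω - Z²/2) = √((2ω - Z²/2)² - 4η²(2ω - η²))`
of the wave with minimum `η`. -/
def discr (η ω Z : ℝ) : ℝ :=
  Real.sqrt ((2 * ω - Z ^ 2 / 2) ^ 2 - 4 * η ^ 2 * (2 * ω - η ^ 2))

section Parameters

variable {η ω Z : ℝ}

lemma theta_sq (hω : Z ^ 2 / 4 < ω) :
    theta ω Z ^ 2 = ω - Real.sqrt 2 / 2 * |Z| * Real.sqrt (ω - Z ^ 2 / 8) := by
  have h1 : 0 ≤ ω - Z ^ 2 / 8 := by nlinarith [sq_nonneg Z]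
  have h2 := Real.sq_sqrt h1
  have h3 : Real.sqrt 2 ^ 2 = 2 := Real.sq_sqrt zero_le_two
  rw [theta]
  linear_combination h2 + |Z| ^ 2 / 16 * h3 + 1 / 8 * sq_abs Z

lemma lam_sq (hω : Z ^ 2 / 4 < ω) :
    lam ω Z ^ 2 = ω + Real.sqrt 2 / 2 * |Z| * Real.sqrt (ω - Z ^ 2 / 8) := by
  have h1 : 0 ≤ ω - Z ^ 2 / 8 := by nlinarith [sq_nonneg Z]
  have h2 := Real.sq_sqrt h1
  have h3 : Real.sqrt 2 ^ 2 = 2 := Real.sq_sqrt zero_le_two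
  rw [lam]
  linear_combination h2 + |Z| ^ 2 / 16 * h3 + 1 / 8 * sq_abs Z

lemma halfRange_zero (hω : Z ^ 2 / 4 < ω) :
    halfRange ω |Z| 0 = Real.sqrt 2 / 2 * |Z| * Real.sqrt (ω - Z ^ 2 / 8) := by
  have h1 : 0 ≤ ω - Z ^ 2 / 8 := by nlinarith [sq_nonneg Z]
  have h2 := Real.sq_sqrt h1
  have h3 : Real.sqrt 2 ^ 2 = 2 := Real.sq_sqrt zero_le_two
  rw [halfRange, prodSq, sq_abs]
  rw [show ω ^ 2 - ((2 * ω - Z ^ 2 / 2) ^ 2 - 0 ^ 2) / 4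
    = (Real.sqrt 2 / 2 * |Z| * Real.sqrt (ω - Z ^ 2 / 8)) ^ 2 from ?_,
    Real.sqrt_sq (by positivity)]
  rw [mul_pow, mul_pow, div_pow, h2, h3, sq_abs]
  ring

lemma lam_eq (hω : Z ^ 2 / 4 < ω) : lam ω Z = Real.sqrt (ω + halfRange ω |Z| 0) := by
  rw [halfRange_zero hω, ← lam_sq hω, Real.sqrt_sq]
  unfold lam; positivity

lemma modulus0_eq (hω : Z ^ 2 / 4 < ω) :
    modulus0 ω Z = Real.sqrt (2 * halfRange ω |Z| 0 / (ω + halfRange ω |Z| 0)) := by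
  rw [modulus0, lam_sq hω, ← halfRange_zero hω]
  congr 2
  rw [halfRange_zero hω]
  ring

lemma T1_eq (hZ : Z ≠ 0) (hω : Z ^ 2 / 4 < ω) :
    T1 ω Z = 2 * Real.sqrt 2 * halfPeriod ω |Z| 0 := by
  have hz : 0 < |Z| := abs_pos.2 hZ
  have htc : 0 < 2 * ω - |Z| ^ 2 / 2 := by rw [sq_abs]; linarith
  have hR := halfRange_pos hz le_rfl htc
  have hRω := (le_abs_self _).trans_lt (abs_halfRange_lt hz le_rfl htc)
  have hq := Real.sqrt_pos.2 (show 0 < ω + halfRange ω |Z| 0 by linarith)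
  have hs : Real.sqrt (ω - Z ^ 2 / 4) = waveAt ω (halfRange ω |Z| 0) (peakAngle ω |Z| 0) := by
    rw [waveAt_peakAngle hz le_rfl htc, peakSq, sq_abs]; congr 1; ring
  rw [T1, shift0, hs, modulus0_eq hω, lam_eq hω,
    dnInv_eq_invWaveInt hR hRω peakAngle_nonneg peakAngle_le, ellK, ellF_eq_invWaveInt hR hRω,
    halfPeriod]
  field_simp

lemma bounds_of_mem_Ioo_theta (hω : Z ^ 2 / 4 < ω) (hη : η ∈ Ioo 0 (theta ω Z)) :
    η ^ 2 < ω ∧ 0 < (2 * ω - Z ^ 2 / 2) ^ 2 - 4 * η ^ 2 * (2 * ω - η ^ 2) := by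
  have h1 : 0 ≤ ω - Z ^ 2 / 8 := by nlinarith [sq_nonneg Z]
  have h2 := Real.sq_sqrt h1
  have h3 : Real.sqrt 2 ^ 2 = 2 := Real.sq_sqrt zero_le_two
  have h4 : η ^ 2 < theta ω Z ^ 2 := pow_lt_pow_left₀ hη.2 hη.1.le two_ne_zero
  rw [theta_sq hω] at h4
  have h5 : 0 ≤ Real.sqrt 2 / 2 * |Z| * Real.sqrt (ω - Z ^ 2 / 8) := by positivity
  have h6 : (Real.sqrt 2 / 2 * |Z| * Real.sqrt (ω - Z ^ 2 / 8)) ^ 2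
      = Z ^ 2 / 2 * (ω - Z ^ 2 / 8) := by
    rw [mul_pow, mul_pow, div_pow, h2, h3, sq_abs]; ring
  generalize Real.sqrt 2 / 2 * |Z| * Real.sqrt (ω - Z ^ 2 / 8) = ρ at *
  refine ⟨by linarith, ?_⟩
  have h7 : ρ ^ 2 < (ω - η ^ 2) ^ 2 := pow_lt_pow_left₀ (by linarith) h5 two_ne_zero
  nlinarith

lemma discr_pos (hω : Z ^ 2 / 4 < ω) (hη : η ∈ Ioo 0 (theta ω Z)) : 0 < discr η ω Z :=
  Real.sqrt_pos.2 (bounds_of_mem_Ioo_theta hω hη).2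

lemma discr_sq (hω : Z ^ 2 / 4 < ω) (hη : η ∈ Ioo 0 (theta ω Z)) :
    discr η ω Z ^ 2 = (2 * ω - Z ^ 2 / 2) ^ 2 - 4 * η ^ 2 * (2 * ω - η ^ 2) :=
  Real.sq_sqrt (bounds_of_mem_Ioo_theta hω hη).2.le

lemma discr_lt (hω : Z ^ 2 / 4 < ω) (hη : η ∈ Ioo 0 (theta ω Z)) :
    discr η ω Z < 2 * ω - |Z| ^ 2 / 2 := by
  rw [sq_abs]
  refine lt_of_pow_lt_pow_left₀ 2 (by linarith) ?_
  rw [discr_sq hω hη]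
  have h1 := (bounds_of_mem_Ioo_theta hω hη).1
  have h2 : 0 < η ^ 2 := pow_pos hη.1 2
  nlinarith

lemma halfRange_discr (hω : Z ^ 2 / 4 < ω) (hη : η ∈ Ioo 0 (theta ω Z)) :
    halfRange ω |Z| (discr η ω Z) = ω - η ^ 2 := by
  rw [halfRange, prodSq, discr_sq hω hη, sq_abs,
    ← Real.sqrt_sq (sub_nonneg.2 (bounds_of_mem_Ioo_theta hω hη).1.le)]
  congr 1
  ring

lemma peakValue_eq (hZ : Z ≠ 0) (hω : Z ^ 2 / 4 < ω) (hη : η ∈ Ioo 0 (theta ω Z)) :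
    peakValue η ω Z
      = waveAt ω (halfRange ω |Z| (discr η ω Z)) (peakAngle ω |Z| (discr η ω Z)) := by
  rw [waveAt_peakAngle (abs_pos.2 hZ) (discr_pos hω hη).le (discr_lt hω hη), peakSq, sq_abs,
    peakValue, discr]

lemma eta1_eq (hω : Z ^ 2 / 4 < ω) (hη : η ∈ Ioo 0 (theta ω Z)) :
    eta1 η ω = Real.sqrt (ω + halfRange ω |Z| (discr η ω Z)) := by
  rw [halfRange_discr hω hη, eta1]; congr 1; ring

lemma modulus_eq (hω : Z ^ 2 / 4 < ω) (hη : η ∈ Ioo 0 (theta ω Z)) :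
    modulus η ω = Real.sqrt (2 * halfRange ω |Z| (discr η ω Z)
      / (ω + halfRange ω |Z| (discr η ω Z))) := by
  rw [halfRange_discr hω hη, modulus]; congr 2 <;> ring

lemma halfRange_discr_lt (hZ : Z ≠ 0) (hω : Z ^ 2 / 4 < ω) (hη : η ∈ Ioo 0 (theta ω Z)) :
    halfRange ω |Z| (discr η ω Z) < ω :=
  (le_abs_self _).trans_lt (abs_halfRange_lt (abs_pos.2 hZ) (discr_pos hω hη).le (discr_lt hω hη))

lemma halfRange_discr_pos (hZ : Z ≠ 0) (hω : Z ^ 2 / 4 < ω) (hη : η ∈ Ioo 0 (theta ω Z)) :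
    0 < halfRange ω |Z| (discr η ω Z) :=
  halfRange_pos (abs_pos.2 hZ) (discr_pos hω hη).le (discr_lt hω hη)

lemma shift_eq (hZ : Z ≠ 0) (hω : Z ^ 2 / 4 < ω) (hη : η ∈ Ioo 0 (theta ω Z)) :
    shift η ω Z = ellF (peakAngle ω |Z| (discr η ω Z)) (modulus η ω) := by
  have hR := halfRange_discr_pos hZ hω hη
  have hRω := halfRange_discr_lt hZ hω hη
  rw [shift, peakValue_eq hZ hω hη, eta1_eq hω hη, modulus_eq hω hη,
    dnInv_eq_invWaveInt hR hRω peakAngle_nonneg peakAngle_le, ellF_eq_invWaveInt hR hRω]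

lemma Tplus_eq (hZ : Z ≠ 0) (hω : Z ^ 2 / 4 < ω) (hη : η ∈ Ioo 0 (theta ω Z)) :
    Tplus η ω Z = 2 * Real.sqrt 2 * halfPeriod ω |Z| (discr η ω Z) := by
  have hR := halfRange_discr_pos hZ hω hη
  have hRω := halfRange_discr_lt hZ hω hη
  have hq := Real.sqrt_pos.2 (show 0 < ω + halfRange ω |Z| (discr η ω Z) by linarith)
  rw [Tplus, shift_eq hZ hω hη, ellK, eta1_eq hω hη, modulus_eq hω hη,
    ellF_eq_invWaveInt hR hRω, ellF_eq_invWaveInt hR hRω, halfPeriod]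
  field_simp

lemma eta1_pos (hZ : Z ≠ 0) (hω : Z ^ 2 / 4 < ω) (hη : η ∈ Ioo 0 (theta ω Z)) :
    0 < eta1 η ω := by
  rw [eta1_eq hω hη]
  have hR := halfRange_discr_pos hZ hω hη
  have hRω := halfRange_discr_lt hZ hω hη
  exact Real.sqrt_pos.2 (by linarith)

/-- The equation for the period says that the argument of `dn` reaches `K(k)` at `ξ = L`, where the
peak has its minimum. -/
lemma eta1_mul_add_shift (hZ : Z ≠ 0) (hω : Z ^ 2 / 4 < ω) {L : ℝ}
    (h : IsPeakParameter L Z ω η) :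
    eta1 η ω / Real.sqrt 2 * L + (if 0 < Z then shift η ω Z else -shift η ω Z)
      = ellK (modulus η ω) := by
  obtain ⟨hη, h⟩ := h
  have h1 := eta1_pos hZ hω hη
  rcases h with ⟨hpos, hT⟩ | ⟨hneg, -, hT⟩
  · rw [if_pos hpos]
    have hL : L = Real.sqrt 2 / eta1 η ω * (ellK (modulus η ω) - shift η ω Z) := by
      rw [Tminus] at hT
      linear_combination -hT / 2
    rw [hL]
    field_simp
    ring
  · rw [if_neg hneg.not_gt]
    have hL : L = Real.sqrt 2 / eta1 η ω * (ellK (modulus η ω) + shift η ω Z) := by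
      rw [Tplus] at hT
      linear_combination -hT / 2
    rw [hL]
    field_simp
    ring

end Parameters

/-! ### Non-degeneracy of the Robin condition -/

lemma ampIntegral_eq {ω R : ℝ} (h : |R| < ω) (θ : ℝ) :
    ampIntegral ω R θ = Real.sqrt 2 * (ω * (waveInt ω R θ - waveInt ω R (Real.pi / 2))
      - (ω ^ 2 - R ^ 2) * (invWaveInt ω R θ - invWaveInt ω R (Real.pi / 2))) := by
  have hw : Continuous (waveAt ω R) := continuous_waveAt ω R
  have hc := continuous_inv_waveAt h
  rw [ampIntegral]
  congr 1
  rw [waveInt, waveInt, invWaveInt, invWaveInt,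
    intervalIntegral.integral_interval_sub_left (hw.intervalIntegrable _ _)
      (hw.intervalIntegrable _ _),
    intervalIntegral.integral_interval_sub_left (hc.intervalIntegrable _ _)
      (hc.intervalIntegrable _ _), ← intervalIntegral.integral_const_mul,
    ← intervalIntegral.integral_const_mul,
    ← intervalIntegral.integral_sub ((hw.const_mul _).intervalIntegrable _ _)
      ((hc.const_mul _).intervalIntegrable _ _)]
  simp only [mul_one_div]

lemma waveInt_neg (ω R b : ℝ) : waveInt ω R (-b) = -waveInt ω R b := by
  have h := intervalIntegral.integral_comp_neg (a := 0) (b := b) (waveAt ω R)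
  simp only [waveAt, mul_neg, Real.cos_neg, neg_zero] at h
  simp only [waveInt, waveAt]
  rw [h, intervalIntegral.integral_symm]

lemma invWaveInt_neg (ω R b : ℝ) : invWaveInt ω R (-b) = -invWaveInt ω R b := by
  have h := intervalIntegral.integral_comp_neg (a := 0) (b := b) (fun θ => 1 / waveAt ω R θ)
  simp only [waveAt, mul_neg, Real.cos_neg, neg_zero] at h
  simp only [invWaveInt, waveAt]
  rw [h, intervalIntegral.integral_symm]

/-- The identity `∫ (ω φ² - p) = 3 ∫ φ'² - [φ φ']` along the wave from amplitude `b` to its minimum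
gives a bound upon omitting `3 ∫ φ'²`. -/
lemma ampIntegral_le {ω R b : ℝ} (h : |R| < ω) (hb : b ≤ Real.pi / 2) :
    ampIntegral ω R b ≤ Real.sqrt 2 / 2 * (R * Real.sin (2 * b) * waveAt ω R b) := by
  have hd (θ : ℝ) : HasDerivAt (fun θ => ampIntegral ω R θ
      - Real.sqrt 2 / 2 * (R * Real.sin (2 * θ) * waveAt ω R θ))
      (Real.sqrt 2 * (3 / 2 * ((R * Real.sin (2 * θ)) ^ 2 / waveAt ω R θ))) θ := by
    have h2 : HasDerivAt (fun θ : ℝ => 2 * θ) 2 θ := by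
      simpa using (hasDerivAt_id θ).const_mul 2
    have hp := (waveAt_pos h θ).ne'
    refine ((hasDerivAt_ampIntegral h θ).sub (((h2.sin.const_mul R).mul
      (hasDerivAt_waveAt h θ)).const_mul _)).congr_deriv ?_
    have hs := waveAt_sq h θ
    have hs2 := sq_mul_sin_sq_eq h θ
    field_simp
    linear_combination 2 * waveAt ω R θ ^ 2 * hs - 2 * hs2
  have hmono := monotone_of_deriv_nonneg (fun θ => (hd θ).differentiableAt) fun θ => by
    rw [(hd θ).deriv]
    have := waveAt_pos h θ
    positivity
  have h1 := hmono hb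
  have h0 : ampIntegral ω R (Real.pi / 2) = 0 := by simp [ampIntegral]
  simp only [h0, mul_div_cancel₀ Real.pi (two_ne_zero' ℝ), Real.sin_pi] at h1
  linarith

/-- The Robin expression `ψ' + (Z / 2) ψ` at a point where `φ' = -(Z / 2) φ`. -/
lemma evenSolDeriv_add_mul {ω R θ Z s t : ℝ} (hs : waveAt ω R θ ^ 2 = s)
    (hslope : slopeAt R θ = -(Z / 2) * waveAt ω R θ) (ht : t = 2 * s - 2 * ω + Z ^ 2 / 2) :
    evenSolDeriv ω R θ + Z / 2 * evenSol ω R θ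
      = waveAt ω R θ / 2 * (-(t * ampIntegral ω R θ) + Z * (ω * s + (ω ^ 2 - R ^ 2))) := by
  rw [evenSolDeriv, evenSol, hslope, ht, ← hs]
  ring

/-- The amplitude of the peak at the defect. -/
def startAngle (η ω Z : ℝ) : ℝ :=
  if 0 < Z then peakAngle ω |Z| (discr η ω Z) else -peakAngle ω |Z| (discr η ω Z)

lemma waveAt_neg (ω R θ : ℝ) : waveAt ω R (-θ) = waveAt ω R θ := by
  simp [waveAt]

section Boundary

variable {η ω Z : ℝ}

lemma waveAt_startAngle_sq (hZ : Z ≠ 0) (hω : Z ^ 2 / 4 < ω) (hη : η ∈ Ioo 0 (theta ω Z)) :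
    waveAt ω (halfRange ω |Z| (discr η ω Z)) (startAngle η ω Z) ^ 2
      = peakSq ω |Z| (discr η ω Z) := by
  have ht := discr_pos hω hη
  have htc := discr_lt hω hη
  have : waveAt ω (halfRange ω |Z| (discr η ω Z)) (startAngle η ω Z)
      = waveAt ω (halfRange ω |Z| (discr η ω Z)) (peakAngle ω |Z| (discr η ω Z)) := by
    unfold startAngle
    split_ifs
    · rfl
    · rw [waveAt_neg]
  rw [this, waveAt_peakAngle (abs_pos.2 hZ) ht.le htc, Real.sq_sqrt (peakSq_pos ht.le htc).le]

/-- The peak satisfies `φ'(0+) = -(Z / 2) φ(0)`. -/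
lemma slopeAt_startAngle (hZ : Z ≠ 0) (hω : Z ^ 2 / 4 < ω) (hη : η ∈ Ioo 0 (theta ω Z)) :
    slopeAt (halfRange ω |Z| (discr η ω Z)) (startAngle η ω Z)
      = -(Z / 2) * waveAt ω (halfRange ω |Z| (discr η ω Z)) (startAngle η ω Z) := by
  have ht := discr_pos hω hη
  have htc := discr_lt hω hη
  have hz : 0 < |Z| := abs_pos.2 hZ
  have h1 := sin_two_mul_peakAngle hz ht.le htc
  have h2 := waveAt_peakAngle hz ht.le htc
  have h3 : Real.sqrt 2 * Real.sqrt 2 = 2 := Real.mul_self_sqrt zero_le_two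
  have h3' : Real.sqrt 2 ≠ 0 := by positivity
  unfold startAngle
  split_ifs with hpos
  · rw [slopeAt, h1, h2, abs_of_pos hpos, div_div, h3]; ring
  · rw [slopeAt, waveAt_neg, mul_neg, Real.sin_neg, mul_neg, h1, h2,
      abs_of_neg (lt_of_le_of_ne (not_lt.1 hpos) hZ), neg_div, neg_neg, div_div, h3]; ring

/-- The even solution of the linearized equation violates the jump condition. For `Z > 0` the
Robin expression is positive; for `Z < 0` it may vanish only at a period below `T₁`. -/
lemma evenSol_robin_ne_zero (hZ : Z ≠ 0) (hω : Z ^ 2 / 4 < ω) {L : ℝ}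
    (h : IsPeakParameter L Z ω η) :
    evenSolDeriv ω (halfRange ω |Z| (discr η ω Z)) (startAngle η ω Z)
      + Z / 2 * evenSol ω (halfRange ω |Z| (discr η ω Z)) (startAngle η ω Z) ≠ 0 := by
  obtain ⟨hη, h⟩ := h
  have ht := discr_pos hω hη
  have htc := discr_lt hω hη
  have hz : 0 < |Z| := abs_pos.2 hZ
  have hRω := abs_halfRange_lt hz ht.le htc
  have hs := waveAt_startAngle_sq hZ hω hη
  rw [evenSolDeriv_add_mul hs (slopeAt_startAngle hZ hω hη) (t := discr η ω Z)
    (by rw [peakSq, sq_abs]; ring)]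
  refine mul_ne_zero (div_pos (waveAt_pos hRω _) two_pos).ne' ?_
  have hpR : ω ^ 2 - halfRange ω |Z| (discr η ω Z) ^ 2 = prodSq ω |Z| (discr η ω Z) := by
    rw [halfRange_sq hz ht.le htc]; ring
  have hsp := peakSq_pos (ω := ω) ht.le htc
  have hpp := prodSq_pos (ω := ω) ht.le htc
  rcases h with ⟨hpos, -⟩ | ⟨hneg, hT1, hT⟩
  · have h1 := ampIntegral_le (b := peakAngle ω |Z| (discr η ω Z)) hRω peakAngle_le
    rw [sin_two_mul_peakAngle hz ht.le htc, waveAt_peakAngle hz ht.le htc] at h1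
    have h3 : Real.sqrt 2 / 2 * (|Z| * Real.sqrt (peakSq ω |Z| (discr η ω Z)) / Real.sqrt 2
        * Real.sqrt (peakSq ω |Z| (discr η ω Z))) = Z * peakSq ω |Z| (discr η ω Z) / 2 := by
      have h4 := Real.sq_sqrt hsp.le
      rw [abs_of_pos hpos] at *
      field_simp
      rw [h4]
    rw [h3] at h1
    rw [startAngle, if_pos hpos, hpR]
    have h5 := mul_le_mul_of_nonneg_left h1 ht.le
    have h6 : discr η ω Z < 2 * ω := by nlinarith [sq_nonneg |Z|]
    have h7 := mul_pos hpos hsp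
    have h8 := mul_pos hpos hpp
    generalize peakSq ω |Z| (discr η ω Z) = s at *
    refine ne_of_gt ?_
    nlinarith
  · rw [startAngle, if_neg hneg.not_gt, ampIntegral_eq hRω, waveInt_neg, invWaveInt_neg, hpR]
    intro h0
    have hslope : periodSlope ω |Z| (discr η ω Z) = 0 := by
      rw [periodSlope, halfMass, halfPeriod, abs_of_neg hneg] at *
      have := ht.ne'
      field_simp
      linear_combination h0
    have hlt := halfPeriod_lt_of_periodSlope_eq_zero hz ht htc hslope
    rw [T1_eq hZ hω, ← hT, Tplus_eq hZ hω hη] at hT1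
    have : 0 < 2 * Real.sqrt 2 := by positivity
    exact absurd (lt_of_mul_lt_mul_left hT1 this.le) hlt.not_gt

end Boundary

/-! ### Weak derivatives on the line -/

section Weak

variable {f g g₁ g₂ f' g' : ℝ → ℂ} {Ω Ω' : Set ℝ} {χ : ℝ → ℝ}

lemma integrable_mul_of_tsupport_subset (hχ : Continuous χ) (hc : HasCompactSupport χ)
    (hs : tsupport χ ⊆ Ω) (hf : LocallyIntegrableOn f Ω) :
    Integrable fun x => (χ x : ℂ) * f x := by
  have h1 : IntegrableOn f (tsupport χ) := hf.integrableOn_compact_subset hs hc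
  have h2 : IntegrableOn (fun x => (χ x : ℂ) * f x) (tsupport χ) :=
    h1.continuousOn_mul (Complex.continuous_ofReal.comp hχ).continuousOn hc
  refine (integrableOn_iff_integrable_of_support_subset fun x hx => ?_).1 h2
  refine subset_tsupport χ fun h0 => hx ?_
  simp [h0]

lemma setIntegral_mul_of_tsupport_subset (hs : tsupport χ ⊆ Ω) :
    ∫ x in Ω, (χ x : ℂ) * f x = ∫ x, (χ x : ℂ) * f x := by
  refine setIntegral_eq_integral_of_forall_compl_eq_zero fun x hx => ?_
  rw [image_eq_zero_of_notMem_tsupport fun h => hx (hs h)]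
  simp

lemma ae_eq_zero_of_forall_test (hΩ : IsOpen Ω) (hf : LocallyIntegrableOn f Ω)
    (h : ∀ χ : ℝ → ℝ, ContDiff ℝ ((⊤ : ℕ∞) : WithTop ℕ∞) χ → HasCompactSupport χ →
      tsupport χ ⊆ Ω → ∫ x, (χ x : ℂ) * f x = 0) :
    ∀ᵐ x, x ∈ Ω → f x = 0 :=
  hΩ.ae_eq_zero_of_integral_contDiff_smul_eq_zero hf fun χ h1 h2 h3 => by
    simpa only [Complex.real_smul] using h χ h1 h2 h3

lemma HasWeakDerivOn.integral_eq (h : HasWeakDerivOn f g Ω)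
    (h1 : ContDiff ℝ ((⊤ : ℕ∞) : WithTop ℕ∞) χ) (h2 : HasCompactSupport χ)
    (h3 : tsupport χ ⊆ Ω) :
    ∫ x, ((deriv χ x : ℝ) : ℂ) * f x = -∫ x, (χ x : ℂ) * g x := by
  have := h.2.2 χ h1 h2 h3
  rwa [setIntegral_mul_of_tsupport_subset h3,
    setIntegral_mul_of_tsupport_subset (tsupport_deriv_subset.trans h3)] at this

lemma HasWeakDerivOn.mono (h : HasWeakDerivOn f g Ω) (hs : Ω' ⊆ Ω) : HasWeakDerivOn f g Ω' := by
  refine ⟨h.1.mono_set hs, h.2.1.mono_set hs, fun χ h1 h2 h3 => ?_⟩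
  rw [setIntegral_mul_of_tsupport_subset h3,
    setIntegral_mul_of_tsupport_subset (tsupport_deriv_subset.trans h3)]
  exact h.integral_eq h1 h2 (h3.trans hs)

lemma HasWeakDerivOn.congr (h : HasWeakDerivOn f g Ω) (hf : f =ᵐ[volume.restrict Ω] f')
    (hg : g =ᵐ[volume.restrict Ω] g') : HasWeakDerivOn f' g' Ω := by
  refine ⟨h.1.congr hf, h.2.1.congr hg, fun χ h1 h2 h3 => ?_⟩
  have e1 : ∫ x in Ω, ((deriv χ x : ℝ) : ℂ) * f x = ∫ x in Ω, ((deriv χ x : ℝ) : ℂ) * f' x :=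
    integral_congr_ae (hf.mono fun x hx => by simp only [hx])
  have e2 : ∫ x in Ω, (χ x : ℂ) * g x = ∫ x in Ω, (χ x : ℂ) * g' x :=
    integral_congr_ae (hg.mono fun x hx => by simp only [hx])
  rw [← e1, ← e2]
  exact h.2.2 χ h1 h2 h3

lemma HasWeakDerivOn.ae_unique (hΩ : IsOpen Ω) (h₁ : HasWeakDerivOn f g₁ Ω)
    (h₂ : HasWeakDerivOn f g₂ Ω) : g₁ =ᵐ[volume.restrict Ω] g₂ := by
  have h := ae_eq_zero_of_forall_test (f := g₁ - g₂) hΩ (h₁.2.1.sub h₂.2.1)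
    fun χ h1 h2 h3 => by
      have e1 := h₁.integral_eq h1 h2 h3
      have e2 := h₂.integral_eq h1 h2 h3
      simp only [Pi.sub_apply, mul_sub]
      rw [integral_sub (integrable_mul_of_tsupport_subset h1.continuous h2 h3 h₁.2.1)
        (integrable_mul_of_tsupport_subset h1.continuous h2 h3 h₂.2.1)]
      rw [e1, neg_inj] at e2
      rw [e2, sub_self]
  rw [EventuallyEq, ae_restrict_iff' hΩ.measurableSet]
  exact h.mono fun x hx hxΩ => sub_eq_zero.1 (hx hxΩ)

lemma hasWeakDerivOn_weakDeriv (h : ∃ g, HasWeakDerivOn f g Ω) :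
    HasWeakDerivOn f (weakDeriv Ω f) Ω := by
  rw [weakDeriv, dif_pos h]
  exact h.choose_spec

lemma hasWeakDerivOn_of_hasDerivAt (hd : ∀ x, HasDerivAt f (g x) x) (hg : Continuous g) :
    HasWeakDerivOn f g Ω := by
  have hf : Continuous f := continuous_iff_continuousAt.2 fun x => (hd x).continuousAt
  suffices HasWeakDerivOn f g univ from this.mono (subset_univ _)
  refine ⟨hf.locallyIntegrable.locallyIntegrableOn _, hg.locallyIntegrable.locallyIntegrableOn _,
    fun χ h1 h2 h3 => ?_⟩
  have hχ' : Continuous (deriv χ) := h1.continuous_deriv (by simp)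
  have i1 := integrable_mul_of_tsupport_subset hχ' h2.deriv (subset_univ _)
    (hf.locallyIntegrable.locallyIntegrableOn univ)
  have i2 := integrable_mul_of_tsupport_subset h1.continuous h2 h3
    (hg.locallyIntegrable.locallyIntegrableOn univ)
  have i3 := integrable_mul_of_tsupport_subset h1.continuous h2 h3
    (hf.locallyIntegrable.locallyIntegrableOn univ)
  have := integral_eq_zero_of_hasDerivAt_of_integrable
    (f := fun x => (χ x : ℂ) * f x)
    (f' := fun x => ((deriv χ x : ℝ) : ℂ) * f x + (χ x : ℂ) * g x)
    (fun x => ((h1.differentiable (by simp) x).hasDerivAt.ofReal_comp).mul (hd x))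
    (i1.add i2) i3
  rw [integral_add i1 i2] at this
  simp only [Measure.restrict_univ]
  exact eq_neg_of_add_eq_zero_left this

/-- A smooth function with vanishing integral and compact support in an interval is the derivative
of such a function. -/
lemma exists_test_primitive {a b : ℝ} (hab : a < b) {κ : ℝ → ℝ}
    (h1 : ContDiff ℝ ((⊤ : ℕ∞) : WithTop ℕ∞) κ)
    (h2 : HasCompactSupport κ) (h3 : tsupport κ ⊆ Ioo a b) (h0 : ∫ x, κ x = 0) :
    ∃ K : ℝ → ℝ, ContDiff ℝ ((⊤ : ℕ∞) : WithTop ℕ∞) K ∧ HasCompactSupport K ∧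
      tsupport K ⊆ Ioo a b ∧ deriv K = κ := by
  obtain ⟨c, d, hcd, hac, hdb⟩ : ∃ c d, tsupport κ ⊆ Icc c d ∧ a < c ∧ d < b := by
    have hS : IsCompact (insert ((a + b) / 2) (tsupport κ)) := h2.isCompact.insert _
    have hne : (insert ((a + b) / 2) (tsupport κ)).Nonempty := insert_nonempty _ _
    have hsub : insert ((a + b) / 2) (tsupport κ) ⊆ Ioo a b :=
      insert_subset ⟨by linarith, by linarith⟩ h3
    exact ⟨_, _, fun x hx => ⟨csInf_le hS.bddBelow (mem_insert_of_mem _ hx),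
      le_csSup hS.bddAbove (mem_insert_of_mem _ hx)⟩, (hsub (hS.sInf_mem hne)).1,
      (hsub (hS.sSup_mem hne)).2⟩
  have hκ : Continuous κ := h1.continuous
  have hd (x : ℝ) : HasDerivAt (fun x => ∫ t in a..x, κ t) (κ x) x :=
    intervalIntegral.integral_hasDerivAt_right (hκ.intervalIntegrable _ _)
      (hκ.stronglyMeasurableAtFilter _ _) hκ.continuousAt
  have hderiv : deriv (fun x => ∫ t in a..x, κ t) = κ := funext fun x => (hd x).deriv
  have hzero : ∀ t, t ∉ Icc c d → κ t = 0 := fun t ht =>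
    image_eq_zero_of_notMem_tsupport fun h => ht (hcd h)
  have hsupp : tsupport (fun x => ∫ t in a..x, κ t) ⊆ Icc c d := by
    refine closure_minimal (fun x hx => ?_) isClosed_Icc
    by_contra hxI
    refine hx ?_
    rcases lt_or_ge x c with hxc | hxc
    · refine (intervalIntegral.integral_congr fun t ht => hzero t fun h => ?_).trans
        intervalIntegral.integral_zero
      exact absurd (h.1.trans ht.2) (max_lt hac hxc).not_ge
    · have hdx : d < x := by
        by_contra hdx
        exact hxI ⟨hxc, not_lt.1 hdx⟩
      refine (intervalIntegral.integral_eq_integral_of_support_subset fun t ht => ?_).trans h0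
      have := hcd (subset_tsupport κ ht)
      exact ⟨hac.trans_le this.1, this.2.trans hdx.le⟩
  refine ⟨_, contDiff_infty_iff_deriv.2 ⟨fun x => (hd x).differentiableAt, ?_⟩, ?_, ?_, hderiv⟩
  · rw [hderiv]; exact h1
  · exact isCompact_Icc.of_isClosed_subset (isClosed_tsupport _) hsupp
  · exact hsupp.trans (Icc_subset_Ioo hac hdb)

/-- A locally integrable function on an interval with vanishing weak derivative is constant
(du Bois-Reymond). -/
lemma ae_eq_const_of_hasWeakDerivOn_zero {a b : ℝ} (hab : a < b)
    (h : HasWeakDerivOn f 0 (Ioo a b)) : ∃ C : ℂ, ∀ᵐ x, x ∈ Ioo a b → f x = C := by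
  obtain ⟨χ₀, s1, s2, s3, s0⟩ : ∃ χ₀ : ℝ → ℝ, ContDiff ℝ ((⊤ : ℕ∞) : WithTop ℕ∞) χ₀ ∧
      HasCompactSupport χ₀ ∧ tsupport χ₀ ⊆ Ioo a b ∧ ∫ x, χ₀ x = 1 := by
    let B : ContDiffBump ((a + b) / 2) := ⟨(b - a) / 8, (b - a) / 4, by linarith, by linarith⟩
    refine ⟨B.normed volume, B.contDiff_normed, B.hasCompactSupport_normed, ?_,
      B.integral_normed⟩
    rw [B.tsupport_normed_eq, Real.closedBall_eq_Icc]
    exact Icc_subset_Ioo (by simp only [B]; linarith) (by simp only [B]; linarith)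
  refine ⟨∫ x, (χ₀ x : ℂ) * f x, ?_⟩
  have hC : LocallyIntegrableOn (fun _ : ℝ => ∫ x, (χ₀ x : ℂ) * f x) (Ioo a b) :=
    (continuous_const.locallyIntegrable).locallyIntegrableOn _
  have := ae_eq_zero_of_forall_test (f := f - fun _ => ∫ x, (χ₀ x : ℂ) * f x) isOpen_Ioo
    (h.1.sub hC) fun χ h1 h2 h3 => by
    have i0 := integrable_mul_of_tsupport_subset s1.continuous s2 s3 h.1
    have i1 := integrable_mul_of_tsupport_subset h1.continuous h2 h3 h.1
    have i2 := integrable_mul_of_tsupport_subset h1.continuous h2 h3 hC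
    have hχi : Integrable χ := h1.continuous.integrable_of_hasCompactSupport h2
    have hχ₀i : Integrable χ₀ := s1.continuous.integrable_of_hasCompactSupport s2
    -- `χ - (∫ χ) χ₀` has vanishing integral, so it is the derivative of a test function
    obtain ⟨K, k1, k2, k3, k4⟩ := exists_test_primitive hab
      (κ := fun x => χ x - (∫ y, χ y) * χ₀ x) (h1.sub (contDiff_const.mul s1))
      (h2.sub (s2.mul_left))
      ((tsupport_sub _ _).trans (union_subset h3 ((tsupport_mul_subset_right).trans s3)))
      (by rw [integral_sub hχi (hχ₀i.const_mul _), integral_const_mul, s0]; ring)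
    have e := h.integral_eq k1 k2 k3
    rw [k4] at e
    simp only [Pi.zero_apply, mul_zero, integral_zero, neg_zero, Complex.ofReal_sub,
      Complex.ofReal_mul, sub_mul] at e
    rw [integral_sub i1 (by simpa only [mul_assoc] using i0.const_mul _)] at e
    simp only [mul_assoc, integral_const_mul] at e
    simp only [Pi.sub_apply, mul_sub]
    rw [integral_sub i1 i2, integral_mul_const, integral_complex_ofReal]
    exact e
  exact this.mono fun x hx hxI => sub_eq_zero.1 (hx hxI)

/-- A function whose weak derivative is continuous agrees almost everywhere with a classical
primitive. -/
lemma HasWeakDerivOn.exists_primitive {a b : ℝ} (hab : a < b) (h : HasWeakDerivOn f g (Ioo a b))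
    {q : ℝ → ℂ} (hq : Continuous q) (hg : g =ᵐ[volume.restrict (Ioo a b)] q) :
    ∃ F : ℝ → ℂ, (∀ x, HasDerivAt F (q x) x) ∧ f =ᵐ[volume.restrict (Ioo a b)] F := by
  have hd (x : ℝ) : HasDerivAt (fun x => ∫ t in (0 : ℝ)..x, q t) (q x) x :=
    intervalIntegral.integral_hasDerivAt_right (hq.intervalIntegrable _ _)
      (hq.stronglyMeasurableAtFilter _ _) hq.continuousAt
  have hF : HasWeakDerivOn (fun x => ∫ t in (0 : ℝ)..x, q t) q (Ioo a b) :=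
    hasWeakDerivOn_of_hasDerivAt hd hq
  have h' := h.congr (EventuallyEq.refl _ _) hg
  have hsub : HasWeakDerivOn (f - fun x => ∫ t in (0 : ℝ)..x, q t) 0 (Ioo a b) := by
    refine ⟨h'.1.sub hF.1, (continuous_zero.locallyIntegrable).locallyIntegrableOn _,
      fun χ h1 h2 h3 => ?_⟩
    have h3' := (tsupport_deriv_subset (f := χ)).trans h3
    have hχ' : Continuous (deriv χ) := h1.continuous_deriv (by simp)
    rw [setIntegral_mul_of_tsupport_subset h3']
    simp only [Pi.sub_apply, mul_sub, Pi.zero_apply, mul_zero, integral_zero, neg_zero]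
    rw [integral_sub (integrable_mul_of_tsupport_subset hχ' h2.deriv h3' h'.1)
      (integrable_mul_of_tsupport_subset hχ' h2.deriv h3' hF.1), h'.integral_eq h1 h2 h3,
      hF.integral_eq h1 h2 h3, sub_self]
  obtain ⟨C, hC⟩ := ae_eq_const_of_hasWeakDerivOn_zero hab hsub
  refine ⟨fun x => (∫ t in (0 : ℝ)..x, q t) + C, fun x => (hd x).add_const C, ?_⟩
  rw [EventuallyEq, ae_restrict_iff' measurableSet_Ioo]
  filter_upwards [hC] with x hx hxI
  rw [← hx hxI, Pi.sub_apply, add_sub_cancel]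

/-- A continuous function whose second weak derivative is continuous is twice differentiable. -/
lemma exists_classical_of_hasWeakDerivOn {a b : ℝ} (hab : a < b) (hf : Continuous f)
    (h₁ : HasWeakDerivOn f g₁ (Ioo a b)) (h₂ : HasWeakDerivOn g₁ g₂ (Ioo a b)) {q : ℝ → ℂ}
    (hq : Continuous q) (hg : g₂ =ᵐ[volume.restrict (Ioo a b)] q) :
    ∃ F G : ℝ → ℂ, (∀ x, HasDerivAt F (G x) x) ∧ (∀ x, HasDerivAt G (q x) x) ∧
      EqOn f F (Ioo a b) := by
  obtain ⟨G, hG, hGe⟩ := h₂.exists_primitive hab hq hg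
  have hGc : Continuous G := continuous_iff_continuousAt.2 fun x => (hG x).continuousAt
  obtain ⟨F, hF, hFe⟩ := h₁.exists_primitive hab hGc hGe
  have hFc : Continuous F := continuous_iff_continuousAt.2 fun x => (hF x).continuousAt
  exact ⟨F, G, hF, hG, Measure.eqOn_open_of_ae_eq hFe isOpen_Ioo hf.continuousOn
    hFc.continuousOn⟩

end Weak

/-! ### Regularity of the elements of the kernel -/

lemma zero_mem_kerL1 (L Z ω : ℝ) (φ : ℝ → ℝ) : (0 : ℝ → ℂ) ∈ kerL1 L Z ω φ := by
  have h0 (Ω : Set ℝ) : HasWeakDerivOn (0 : ℝ → ℂ) 0 Ω :=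
    hasWeakDerivOn_of_hasDerivAt (fun x => hasDerivAt_const x 0) continuous_zero
  have hS (Ω : Set ℝ) : MemSobolev 2 (0 : ℝ → ℂ) Ω :=
    ⟨MemLp.zero, 0, h0 Ω, MemLp.zero, 0, h0 Ω, MemLp.zero⟩
  have hΩ : IsOpen (Ioo (-L) L \ {0}) := isOpen_Ioo.sdiff isClosed_singleton
  have hderiv : deriv (0 : ℝ → ℂ) = 0 := funext fun x => deriv_const x (0 : ℂ)
  refine ⟨⟨⟨continuous_zero, fun x => rfl, 0, h0 _, MemLp.zero⟩, hS _, fun n => hS _, 0, 0, ?_, ?_,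
    by simp⟩, ?_⟩
  · rw [hderiv]; exact tendsto_const_nhds
  · rw [hderiv]; exact tendsto_const_nhds
  · have h1 := hasWeakDerivOn_weakDeriv ⟨_, h0 (Ioo (-L) L \ {0})⟩
    have h2 := h1.congr (EventuallyEq.refl _ _) (h1.ae_unique hΩ (h0 _))
    have h3 := (h0 _).congr (h1.ae_unique hΩ (h0 _)).symm (EventuallyEq.refl _ _)
    have h4 := (hasWeakDerivOn_weakDeriv ⟨_, h3⟩).ae_unique hΩ h3
    rw [EventuallyEq, ae_restrict_iff' hΩ.measurableSet] at h4
    rw [EventuallyEq, ae_restrict_iff' measurableSet_Ioo]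
    filter_upwards [h4, volume.ae_ne (0 : ℝ)] with x hx hx0 hxI
    simp [L1, hx ⟨hxI, hx0⟩]

/-- An element of the kernel is a classical solution of `ζ'' = (ω - 3φ²) ζ` between two defects.
Here `Q` is the smooth continuation of the potential from `(0, 2L)`. -/
lemma exists_classical_of_mem_kerL1 {L Z ω : ℝ} (hL : 0 < L) {φ Q : ℝ → ℝ} (hQ : Continuous Q)
    (hQr : ∀ x ∈ Ioo 0 L, φ x = Q x) (hQl : ∀ x ∈ Ioo (-L) 0, φ x = Q (x + 2 * L))
    {ζ : ℝ → ℂ} (hζ : ζ ∈ kerL1 L Z ω φ) :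
    ∃ F G : ℝ → ℂ, (∀ x, HasDerivAt F (G x) x) ∧
      (∀ x, HasDerivAt G (((ω - 3 * Q x ^ 2 : ℝ) : ℂ) * ζ x) x) ∧
      EqOn ζ F (Ioo 0 (2 * L)) := by
  obtain ⟨⟨⟨hc, hper, -⟩, ⟨-, g, hg, -, g₂, hg₂, -⟩, hn, -⟩, hker⟩ := hζ
  set Ω := Ioo (-L) L \ {0} with hΩdef
  have hΩ : IsOpen Ω := isOpen_Ioo.sdiff isClosed_singleton
  have hw1 := hasWeakDerivOn_weakDeriv ⟨_, hg⟩
  have hw2 := hasWeakDerivOn_weakDeriv ⟨_, hg₂.congr (hg.ae_unique hΩ hw1) (EventuallyEq.refl _ _)⟩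
  set w₁ := weakDeriv Ω ζ with hw₁
  set w₂ := weakDeriv Ω w₁ with hw₂
  have hpt : ∀ᵐ x, x ∈ Ioo (-L) L → w₂ x = ((ω - 3 * φ x ^ 2 : ℝ) : ℂ) * ζ x := by
    rw [EventuallyEq, ae_restrict_iff' measurableSet_Ioo] at hker
    filter_upwards [hker] with x hx hxI
    have := hx hxI
    simp only [L1, Pi.zero_apply] at this
    push_cast
    linear_combination -this
  have hl : Ioo (-L) 0 ⊆ Ω := fun x hx => ⟨⟨hx.1, hx.2.trans hL⟩, hx.2.ne⟩
  have hr : Ioo 0 L ⊆ Ω := fun x hx => ⟨⟨by linarith [hx.1], hx.2⟩, hx.1.ne'⟩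
  -- the equation to the left of the defect, translated by one period
  have hcl : Continuous fun x => ((ω - 3 * Q (x + 2 * L) ^ 2 : ℝ) : ℂ) * ζ x := by fun_prop
  obtain ⟨F₁, G₁, hF₁, hG₁, hE₁⟩ := exists_classical_of_hasWeakDerivOn (neg_lt_zero.2 hL) hc
    (hw1.mono hl) (hw2.mono hl) hcl (by
      rw [EventuallyEq, ae_restrict_iff' measurableSet_Ioo]
      filter_upwards [hpt] with x hx hxI
      rw [hx ⟨hxI.1, hxI.2.trans hL⟩, hQl x hxI])
  have hG₁c : Continuous G₁ := continuous_iff_continuousAt.2 fun x => (hG₁ x).continuousAt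
  have hT : ∀ x, x ∈ Ioo L (2 * L) → x - 2 * L ∈ Ioo (-L) 0 := fun x hx =>
    ⟨by linarith [hx.1], by linarith [hx.2]⟩
  obtain ⟨-, u₁, hu₁, -, u₂, hu₂, -⟩ := hn 0
  have hI : Ioo (2 * ((0 : ℤ) : ℝ) * L) (2 * (((0 : ℤ) : ℝ) + 1) * L) = Ioo 0 (2 * L) := by
    simp
  rw [hI] at hu₁ hu₂
  have hcr : Continuous fun x => ((ω - 3 * Q x ^ 2 : ℝ) : ℂ) * ζ x := by fun_prop
  refine exists_classical_of_hasWeakDerivOn (by linarith) hc hu₁ hu₂ hcr ?_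
  have hsr : Ioo 0 L ⊆ Ioo 0 (2 * L) := Ioo_subset_Ioo_right (by linarith)
  have hsl : Ioo L (2 * L) ⊆ Ioo 0 (2 * L) := Ioo_subset_Ioo_left hL.le
  have e1 : u₂ =ᵐ[volume.restrict (Ioo 0 L)] w₂ :=
    (hu₂.mono hsr).ae_unique isOpen_Ioo ((hw2.mono hr).congr
      ((hw1.mono hr).ae_unique isOpen_Ioo (hu₁.mono hsr)) (EventuallyEq.refl _ _))
  have hζT : ζ =ᵐ[volume.restrict (Ioo L (2 * L))] fun x => F₁ (x - 2 * L) := by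
    rw [EventuallyEq, ae_restrict_iff' measurableSet_Ioo]
    refine Eventually.of_forall fun x hx => ?_
    rw [← hE₁ (hT x hx), hper.sub_eq]
  have e2 : u₁ =ᵐ[volume.restrict (Ioo L (2 * L))] fun x => G₁ (x - 2 * L) :=
    ((hu₁.mono hsl).congr hζT (EventuallyEq.refl _ _)).ae_unique isOpen_Ioo
      (hasWeakDerivOn_of_hasDerivAt (fun x => (hF₁ (x - 2 * L)).comp_sub_const x (2 * L))
        (by fun_prop))
  have e3 : u₂ =ᵐ[volume.restrict (Ioo L (2 * L))]
      fun x => ((ω - 3 * Q x ^ 2 : ℝ) : ℂ) * ζ x :=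
    ((hu₂.mono hsl).congr e2 (EventuallyEq.refl _ _)).ae_unique isOpen_Ioo
      (hasWeakDerivOn_of_hasDerivAt (fun x => by
        have := (hG₁ (x - 2 * L)).comp_sub_const x (2 * L)
        rwa [sub_add_cancel, hper.sub_eq] at this) hcr)
  rw [EventuallyEq, ae_restrict_iff' measurableSet_Ioo] at e1 e3 ⊢
  filter_upwards [e1, e3, hpt, volume.ae_ne L] with x h1 h3 hp hne hx
  rcases lt_or_gt_of_ne hne with hlt | hgt
  · rw [h1 ⟨hx.1, hlt⟩, hp ⟨by linarith [hx.1], hlt⟩, hQr x ⟨hx.1, hlt⟩]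
  · exact h3 ⟨hgt, hx.2⟩

/-! ### The kernel -/

/-- Two solutions of the same linear equation have constant Wronskian. -/
lemma wronskian_const {a b : ℝ} {F G ζ : ℝ → ℂ} {u u' V : ℝ → ℝ}
    (hF : ∀ x, HasDerivAt F (G x) x) (hG : ∀ x, HasDerivAt G ((V x : ℂ) * ζ x) x)
    (hζ : EqOn ζ F (Ioo a b)) (hu : ∀ x, HasDerivAt u (u' x) x)
    (hu' : ∀ x, HasDerivAt u' (V x * u x) x) :
    ∃ C : ℂ, ∀ x ∈ Ioo a b, F x * (u' x : ℂ) - G x * (u x : ℂ) = C := by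
  have hd : ∀ x ∈ Ioo a b, HasDerivAt (fun x => F x * (u' x : ℂ) - G x * (u x : ℂ)) 0 x :=
    fun x hx => by
      refine (((hF x).mul (hu' x).ofReal_comp).sub ((hG x).mul (hu x).ofReal_comp)).congr_deriv ?_
      rw [hζ hx]; push_cast; ring
  rcases (Ioo a b).eq_empty_or_nonempty with he | ⟨x₀, hx₀⟩
  · exact ⟨0, by simp [he]⟩
  refine ⟨F x₀ * (u' x₀ : ℂ) - G x₀ * (u x₀ : ℂ), fun x hx => ?_⟩
  exact isOpen_Ioo.is_const_of_deriv_eq_zero isPreconnected_Ioo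
    (fun y hy => (hd y hy).differentiableAt.differentiableWithinAt)
    (fun y hy => (hd y hy).deriv) hx hx₀

lemma wronskian_const_real {u u' v v' V : ℝ → ℝ}
    (hu : ∀ x, HasDerivAt u (u' x) x) (hu' : ∀ x, HasDerivAt u' (V x * u x) x)
    (hv : ∀ x, HasDerivAt v (v' x) x) (hv' : ∀ x, HasDerivAt v' (V x * v x) x) (x y : ℝ) :
    u x * v' x - u' x * v x = u y * v' y - u' y * v y := by
  have hd (x : ℝ) : HasDerivAt (fun x => u x * v' x - u' x * v x) 0 x :=
    (((hu x).mul (hv' x)).sub ((hu' x).mul (hv x))).congr_deriv (by ring)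
  exact is_const_of_deriv_eq_zero (fun x => (hd x).differentiableAt) (fun x => (hd x).deriv) x y

/-- Triviality of the kernel, given a fundamental system of the linearized equation on a period
consisting of a solution `v` that is odd and a solution `u` that is even about `L`: continuity
excludes `v`, and the jump condition excludes `u`. -/
lemma eq_zero_of_fundamental_system {L Z ω : ℝ} (hL : 0 < L) {φ Q u u' v v' : ℝ → ℝ}
    (hQ : Continuous Q) (hQr : ∀ x ∈ Ioo 0 L, φ x = Q x)
    (hQl : ∀ x ∈ Ioo (-L) 0, φ x = Q (x + 2 * L))
    (hu : ∀ x, HasDerivAt u (u' x) x) (hu' : ∀ x, HasDerivAt u' ((ω - 3 * Q x ^ 2) * u x) x)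
    (hv : ∀ x, HasDerivAt v (v' x) x) (hv' : ∀ x, HasDerivAt v' ((ω - 3 * Q x ^ 2) * v x) x)
    (hW : u L * v' L - u' L * v L ≠ 0)
    (hue : u (2 * L) = u 0) (hue' : u' (2 * L) = -u' 0)
    (hvo : v (2 * L) = -v 0) (hv0 : v 0 ≠ 0) (hrobin : u' 0 + Z / 2 * u 0 ≠ 0)
    {ζ : ℝ → ℂ} (hζ : ζ ∈ kerL1 L Z ω φ) : ζ = 0 := by
  obtain ⟨F, G, hF, hG, hE⟩ := exists_classical_of_mem_kerL1 hL hQ hQr hQl hζ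
  obtain ⟨⟨⟨hc, hper, -⟩, -, -, p, m, hp, hm, hpm⟩, -⟩ := hζ
  obtain ⟨A, hA⟩ := wronskian_const hF hG hE hv hv'
  obtain ⟨B, hB⟩ := wronskian_const hF hG hE hu hu'
  set W : ℝ := u L * v' L - u' L * v L with hWdef
  have hWx : ∀ x, u x * v' x - u' x * v x = W := fun x => wronskian_const_real hu hu' hv hv' x L
  have hWc : (W : ℂ) ≠ 0 := Complex.ofReal_ne_zero.2 hW
  -- the solution and its derivative as combinations of the fundamental system
  have hcomb : ∀ x ∈ Ioo 0 (2 * L), F x = A / W * u x - B / W * v x := fun x hx => by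
    have hWx' : (u x : ℂ) * v' x - u' x * v x = W := by exact_mod_cast hWx x
    field_simp
    rw [← hWx', ← hA x hx, ← hB x hx]; ring
  have hcomb' : ∀ x ∈ Ioo 0 (2 * L), G x = A / W * u' x - B / W * v' x := fun x hx => by
    have hWx' : (u x : ℂ) * v' x - u' x * v x = W := by exact_mod_cast hWx x
    field_simp
    rw [← hWx', ← hA x hx, ← hB x hx]; ring
  generalize (A / W : ℂ) = α at hcomb hcomb'
  generalize (B / W : ℂ) = β at hcomb hcomb'
  have hcu : Continuous u := continuous_iff_continuousAt.2 fun x => (hu x).continuousAt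
  have hcu' : Continuous u' := continuous_iff_continuousAt.2 fun x => (hu' x).continuousAt
  have hcv : Continuous v := continuous_iff_continuousAt.2 fun x => (hv x).continuousAt
  have hcv' : Continuous v' := continuous_iff_continuousAt.2 fun x => (hv' x).continuousAt
  have h2L : (0 : ℝ) < 2 * L := by linarith
  -- the representation extends to the closed period
  have hclosed : EqOn ζ (fun x => α * u x - β * v x) (Icc 0 (2 * L)) := by
    rw [← closure_Ioo h2L.ne]
    exact EqOn.closure (fun x hx => (hE hx).trans (hcomb x hx)) hc (by fun_prop)
  have hderiv : ∀ x ∈ Ioo 0 (2 * L), deriv ζ x = α * u' x - β * v' x := fun x hx => by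
    rw [← hcomb' x hx, ← (hF x).deriv]
    exact (hE.eventuallyEq_of_mem (isOpen_Ioo.mem_nhds hx)).deriv_eq
  have hz0 := hclosed (left_mem_Icc.2 h2L.le)
  have hz1 := hclosed (right_mem_Icc.2 h2L.le)
  have hpz : ζ (2 * L) = ζ 0 := by simpa using hper 0
  have hβ : β = 0 := by
    simp only [hue, hvo] at hz1 hz0
    rw [hpz, hz0] at hz1
    push_cast at hz1
    have : β * (v 0 : ℂ) = 0 := by linear_combination -hz1 / 2
    exact (mul_eq_zero.1 this).resolve_right (Complex.ofReal_ne_zero.2 hv0)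
  have hlimp : p = α * u' 0 := by
    refine tendsto_nhds_unique hp ?_
    have : Tendsto (fun x => α * (u' x : ℂ)) (𝓝[>] 0) (𝓝 (α * u' 0)) :=
      (Continuous.tendsto (by fun_prop) 0).mono_left nhdsWithin_le_nhds
    refine this.congr' ?_
    filter_upwards [Ioo_mem_nhdsGT h2L] with x hx
    rw [hderiv x hx, hβ]; ring
  have hlimm : m = α * u' (2 * L) := by
    refine tendsto_nhds_unique hm ?_
    have : Tendsto (fun x => α * (u' (x + 2 * L) : ℂ)) (𝓝[<] 0) (𝓝 (α * u' (0 + 2 * L))) :=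
      (Continuous.tendsto (f := fun x : ℝ => α * (u' (x + 2 * L) : ℂ))
        (by fun_prop) 0).mono_left nhdsWithin_le_nhds
    rw [zero_add] at this
    refine this.congr' ?_
    filter_upwards [Ioo_mem_nhdsLT (show -(2 * L) < 0 by linarith)] with x hx
    have h1 : deriv ζ (x + 2 * L) = deriv ζ x := by
      rw [← deriv_comp_add_const, show (fun y => ζ (y + 2 * L)) = ζ from funext hper]
    rw [← h1, hderiv (x + 2 * L) ⟨by linarith [hx.1], by linarith [hx.2]⟩, hβ]; ring
  have hα : α = 0 := by
    simp only [hβ, zero_mul, sub_zero] at hz0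
    rw [hlimp, hlimm, hue', hz0] at hpm
    push_cast at hpm
    have : α * ((u' 0 + Z / 2 * u 0 : ℝ) : ℂ) = 0 := by
      push_cast; linear_combination hpm / 2
    exact (mul_eq_zero.1 this).resolve_right (Complex.ofReal_ne_zero.2 hrobin)
  funext x
  obtain ⟨y, hy, hxy⟩ := hper.exists_mem_Ico₀ h2L x
  rw [hxy, hclosed ⟨hy.1, hy.2.le⟩, hα, hβ]
  simp

/-- The smooth amplitude `θ(x) = am(η₁ x / √2 ± a; k)` of the peak on `[0, 2L]`. -/
def peakAmp (Z ω η x : ℝ) : ℝ :=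
  am (eta1 η ω / Real.sqrt 2 * x + (if 0 < Z then shift η ω Z else -shift η ω Z)) (modulus η ω)

section Peak

variable {L Z ω η : ℝ}

lemma modulus_pos (hZ : Z ≠ 0) (hω : Z ^ 2 / 4 < ω) (hη : η ∈ Ioo 0 (theta ω Z)) :
    0 < modulus η ω := by
  rw [modulus_eq hω hη]
  exact waveMod_pos (halfRange_discr_pos hZ hω hη) (halfRange_discr_lt hZ hω hη)

lemma modulus_lt_one (hZ : Z ≠ 0) (hω : Z ^ 2 / 4 < ω) (hη : η ∈ Ioo 0 (theta ω Z)) :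
    modulus η ω < 1 := by
  rw [modulus_eq hω hη]
  exact waveMod_lt_one (halfRange_discr_pos hZ hω hη) (halfRange_discr_lt hZ hω hη)

lemma eta1_mul_dn (hZ : Z ≠ 0) (hω : Z ^ 2 / 4 < ω) (hη : η ∈ Ioo 0 (theta ω Z)) (u : ℝ) :
    eta1 η ω * dn u (modulus η ω)
      = waveAt ω (halfRange ω |Z| (discr η ω Z)) (am u (modulus η ω)) := by
  rw [modulus_eq hω hη, eta1_eq hω hη]
  exact sqrt_mul_dn (halfRange_discr_pos hZ hω hη) (halfRange_discr_lt hZ hω hη) u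

lemma hasDerivAt_peakAmp (hZ : Z ≠ 0) (hω : Z ^ 2 / 4 < ω) (hη : η ∈ Ioo 0 (theta ω Z)) (x : ℝ) :
    HasDerivAt (peakAmp Z ω η)
      (waveAt ω (halfRange ω |Z| (discr η ω Z)) (peakAmp Z ω η x) / Real.sqrt 2) x := by
  have h1 : HasDerivAt (fun x => eta1 η ω / Real.sqrt 2 * x
      + (if 0 < Z then shift η ω Z else -shift η ω Z)) (eta1 η ω / Real.sqrt 2) x := by
    simpa using ((hasDerivAt_id x).const_mul (eta1 η ω / Real.sqrt 2)).add_const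
      (if 0 < Z then shift η ω Z else -shift η ω Z)
  refine ((hasDerivAt_am (modulus_pos hZ hω hη).le (modulus_lt_one hZ hω hη) _).comp x
    h1).congr_deriv ?_
  rw [peakAmp, ← eta1_mul_dn hZ hω hη]
  ring

lemma peakAmp_zero (hZ : Z ≠ 0) (hω : Z ^ 2 / 4 < ω) (hη : η ∈ Ioo 0 (theta ω Z)) :
    peakAmp Z ω η 0 = startAngle η ω Z := by
  have h0 := (modulus_pos hZ hω hη).le
  have h1 := modulus_lt_one hZ hω hη
  rw [peakAmp, startAngle, mul_zero, zero_add, shift_eq hZ hω hη]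
  split_ifs
  · rw [am_ellF h0 h1]
  · rw [am_neg h0 h1, am_ellF h0 h1]

lemma peakAmp_two_mul_sub (hZ : Z ≠ 0) (hω : Z ^ 2 / 4 < ω) (h : IsPeakParameter L Z ω η)
    (x : ℝ) : peakAmp Z ω η (2 * L - x) = Real.pi - peakAmp Z ω η x := by
  have h0 := (modulus_pos hZ hω h.1).le
  have h1 := modulus_lt_one hZ hω h.1
  rw [peakAmp, peakAmp, ← am_two_mul_ellK_sub h0 h1, ← eta1_mul_add_shift hZ hω h]
  congr 1
  ring

lemma peak_eq_of_mem_right (hL : 0 < L) (hZ : Z ≠ 0) (hω : Z ^ 2 / 4 < ω)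
    (hη : η ∈ Ioo 0 (theta ω Z)) {x : ℝ} (hx : x ∈ Ioo 0 L) :
    peak L Z ω η x = waveAt ω (halfRange ω |Z| (discr η ω Z)) (peakAmp Z ω η x) := by
  have hr : round (x / (2 * L)) = 0 := by
    rw [round_eq_zero_iff]
    refine ⟨?_, ?_⟩
    · have : 0 < x / (2 * L) := div_pos hx.1 (by linarith)
      linarith
    · rw [div_lt_iff₀ (by linarith)]; linarith [hx.2]
  simp only [peak, hr, Int.cast_zero, mul_zero, sub_zero, abs_of_pos hx.1]
  rw [eta1_mul_dn hZ hω hη, peakAmp]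

lemma peak_eq_of_mem_left (hL : 0 < L) (hZ : Z ≠ 0) (hω : Z ^ 2 / 4 < ω)
    (h : IsPeakParameter L Z ω η) {x : ℝ} (hx : x ∈ Ioo (-L) 0) :
    peak L Z ω η x = waveAt ω (halfRange ω |Z| (discr η ω Z)) (peakAmp Z ω η (x + 2 * L)) := by
  have hr : round (x / (2 * L)) = 0 := by
    rw [round_eq_zero_iff]
    refine ⟨?_, ?_⟩
    · rw [le_div_iff₀ (by linarith)]; linarith [hx.1]
    · have : x / (2 * L) < 0 := div_neg_of_neg_of_pos hx.2 (by linarith)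
      linarith
  simp only [peak, hr, Int.cast_zero, mul_zero, sub_zero, abs_of_neg hx.2]
  rw [eta1_mul_dn hZ hω h.1, show x + 2 * L = 2 * L - -x by ring,
    peakAmp_two_mul_sub hZ hω h, waveAt_pi_sub, peakAmp]

theorem kerL1_peak_eq (hL : 0 < L) (hZ : Z ≠ 0) (hω : Z ^ 2 / 4 < ω)
    (hη : IsPeakParameter L Z ω η) : kerL1 L Z ω (peak L Z ω η) = {0} := by
  refine Subset.antisymm (fun ζ hζ => ?_) (singleton_subset_iff.2 (zero_mem_kerL1 _ _ _ _))
  have ht := discr_pos hω hη.1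
  have htc := discr_lt hω hη.1
  have hz : 0 < |Z| := abs_pos.2 hZ
  have hR := halfRange_pos hz ht.le htc
  have hRω := abs_halfRange_lt hz ht.le htc
  have hrobin := evenSol_robin_ne_zero hZ hω hη
  have hslope := slopeAt_startAngle hZ hω hη.1
  have hθ := hasDerivAt_peakAmp hZ hω hη.1
  have hθ0 := peakAmp_zero hZ hω hη.1
  have hsym := peakAmp_two_mul_sub hZ hω hη
  have hQr := fun x hx => peak_eq_of_mem_right hL hZ hω hη.1 (x := x) hx
  have hQl := fun x hx => peak_eq_of_mem_left hL hZ hω hη (x := x) hx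
  generalize halfRange ω |Z| (discr η ω Z) = R at *
  have hL2 : peakAmp Z ω η L = Real.pi / 2 := by
    have := hsym L
    rw [show 2 * L - L = L by ring] at this
    linarith
  have h2L : peakAmp Z ω η (2 * L) = Real.pi - peakAmp Z ω η 0 := by simpa using hsym 0
  have hcos : Real.cos (2 * (Real.pi / 2)) = -1 := by
    rw [mul_div_cancel₀ Real.pi (two_ne_zero' ℝ), Real.cos_pi]
  have hsin : Real.sin (2 * (Real.pi / 2)) = 0 := by
    rw [mul_div_cancel₀ Real.pi (two_ne_zero' ℝ), Real.sin_pi]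
  have hRlt : R < ω := (le_abs_self _).trans_lt hRω
  refine eq_zero_of_fundamental_system hL
    (Q := fun x => waveAt ω R (peakAmp Z ω η x))
    (u := fun x => evenSol ω R (peakAmp Z ω η x))
    (u' := fun x => evenSolDeriv ω R (peakAmp Z ω η x))
    (v := fun x => slopeAt R (peakAmp Z ω η x))
    (v' := fun x => (ω - waveAt ω R (peakAmp Z ω η x) ^ 2) * waveAt ω R (peakAmp Z ω η x))
    ?_ hQr hQl (hasDerivAt_evenSol hRω hθ) (hasDerivAt_evenSolDeriv hRω hθ)
    (hasDerivAt_slope hRω hθ) (hasDerivAt_slopeDeriv hRω hθ) ?_ ?_ ?_ ?_ ?_ ?_ hζ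
  · exact (continuous_waveAt ω R).comp
      (continuous_iff_continuousAt.2 fun x => (hθ x).continuousAt)
  · have hw := waveAt_pos hRω (Real.pi / 2)
    have hwsq := waveAt_sq hRω (Real.pi / 2)
    rw [hcos] at hwsq
    have hs0 : slopeAt R (Real.pi / 2) = 0 := by simp [slopeAt, hsin]
    simp only [hL2, evenSol, hs0]
    -- the Wronskian at the minimum `η` is `R η² (2ω² - p - ω η²) = R² (ω + R) η²`
    have : (0 * ampIntegral ω R (Real.pi / 2) - ω * waveAt ω R (Real.pi / 2) ^ 3
        + (2 * ω ^ 2 - (ω ^ 2 - R ^ 2)) * waveAt ω R (Real.pi / 2))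
        * ((ω - waveAt ω R (Real.pi / 2) ^ 2) * waveAt ω R (Real.pi / 2))
        - evenSolDeriv ω R (Real.pi / 2) * 0
        = waveAt ω R (Real.pi / 2) ^ 2 * (R ^ 2 * (ω + R)) := by
      have h3 : waveAt ω R (Real.pi / 2) ^ 3
          = (ω + R * -1) * waveAt ω R (Real.pi / 2) := by rw [← hwsq]; ring
      rw [h3, hwsq]; linear_combination (R * (R ^ 2 + ω * R)) * hwsq
    rw [this]
    have : 0 < ω + R := by linarith
    positivity
  · simp only [h2L, evenSol_pi_sub hRω]
  · simp only [h2L, evenSolDeriv_pi_sub hRω]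
  · simp only [h2L, slopeAt_pi_sub]
  · simp only [hθ0, hslope]
    refine mul_ne_zero (neg_ne_zero.2 (div_ne_zero hZ two_ne_zero)) (waveAt_pos hRω _).ne'
  · simpa only [hθ0] using hrobin

end Peak

end DeltaNLS

end

theorem lemma6p2 (L Z ω η : ℝ) (hL : 0 < L) (hZ : Z ≠ 0) (hω : Z ^ 2 / 4 < ω)
    (hη : DeltaNLS.IsPeakParameter L Z ω η) :
    DeltaNLS.kerL1 L Z ω (DeltaNLS.peak L Z ω η) = {0} :=
  DeltaNLS.kerL1_peak_eq hL hZ hω hη
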